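/- Let $\Omega>0$, $\theta\neq0$, $\mu_0\in\mathbb R$ and $M>1$. Points of $\mathbb R^3$ are written $(x,x^0)$, where $x\in\mathbb R^2$ is the non-commutative and $x^0\in\mathbb R$ the commutative coordinate, and $x\theta^{-1}y=\frac2\theta(x_1y_2-x_2y_1)$. A graph of the orientable $(\bar\varphi\star\varphi)^3$ model has finitely many vertices, each with $4$ or with $6$ cyclically ordered fields, alternately $\bar\varphi,\varphi,\bar\varphi,\varphi,\dots$; each internal line contracts a $\bar\varphi$ with a $\varphi$, each field belongs to at most one line, and the fields that belong to no line are the external ones. The fields $f=(v,j)$, $1\le j\le 2p_v$ with $p_v\in\{2,3\}$, of a vertex $v$ have positions $x_{v,j}\in\mathbb R^2$ and one common commutative coordinate $x^0_v$. Put $I_0=[1,\infty)$, $I_i=[M^{-2i},M^{-2(i-1)}]$ for $i\ge1$, and $$C^i(u,u^0,v)=\int_{I_i}\frac{\sqrt\Omega\,\alpha^{-1/2}\,d\alpha}{2\sqrt{2\pi}^{\,3}\sinh\alpha}\;e^{-\frac\Omega4\coth(\frac\alpha2)|u|^2-\frac\Omega4\tanh(\frac\alpha2)|v|^2-\frac{\mu_0^2}{2\Omega}\alpha-\frac{\Omega}{2\alpha}(u^0)^2}.$$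 Given an assignment $\mu$ of a scale $i_l\in\{0,1,2,\dots\}$ to each internal line $l$ and test functions $f_e\in\mathcal S(\mathbb R^2\times\mathbb R,\mathbb C)$, one for each external field $e$, the sliced (amputated, smeared) amplitude is $$A_{G,\mu}=\int\prod_v\Big[dx^0_v\prod_{j}dx_{v,j}\;\delta\Big(\sum_{j}(-1)^{j+1}x_{v,j}\Big)\,e^{\mathrm i\sum_{j<k}(-1)^{j+k+1}x_{v,j}\theta^{-1}x_{v,k}}\Big]\prod_lC^{i_l}(u_l,u^0_l,v_l)\prod_ef_e(x_e,x^0_e),$$ where $u_l$ and $v_l$ are the difference and the sum of the positions of the two ends of $l$ in $\mathbb R^2$, and $u^0_l$ is the difference of their commutative coordinates. For $i\ge1$ let $G^i_k$, $k=1,\dots,k(i)$, be the connected components of the subgraph $G^i$ made of all lines of scale at least $i$ (with the vertices at their ends). For a subgraph $g$ let $n_4(g)$ be the number of its $4$-field vertices, $N(g)$ the number of fields at vertices of $g$ that belong to no line of $g$, and $\omega(g)=N(g)/2+n_4(g)-3$. **Lemma (crude power counting).** Let $\mathcal F\subset\mathcal S(\mathbb R^2\times\mathbb R,\mathbb C)$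 be a set of test functions that is bounded in each Schwartz seminorm (for instance a finite set). There is a constant $K>0$, depending only on $\theta,\Omega,\mu_0,M$ and $\mathcal F$, such that for every connected graph $G$ of the model with at least one external field, every choice of test functions $f_e\in\mathcal F$ for its external fields, and every scale assignment $\mu$, the integral $A_{G,\mu}$ converges absolutely and $$|A_{G,\mu}|\le K^{n}\prod_{i\ge1}\prod_{k=1}^{k(i)}M^{-\omega(G^i_k)},$$ where $n$ is the number of vertices of $G$. -/

import Mathlib

open MeasureTheory
open scoped SchwartzMap

noncomputable section

namespace NCPhi6

/-- The plane of the two non-commuting coordinates, with the Euclidean norm and Lebesgue measure. -/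
abbrev Plane : Type := EuclideanSpace ℝ (Fin 2)

/-- The two kinds of interaction vertices, `φ̄ ⋆ φ ⋆ φ̄ ⋆ φ` and `φ̄ ⋆ φ ⋆ φ̄ ⋆ φ ⋆ φ̄ ⋆ φ`. -/
inductive VertexKind where
  | phi4
  | phi6

/-- The index of the last field of a vertex, when its fields are numbered from `0`. -/
def VertexKind.lastIndex : VertexKind → ℕ
  | .phi4 => 3
  | .phi6 => 5

/-- The number of fields at a vertex: `4` or `6`. -/
abbrev VertexKind.valence (k : VertexKind) : ℕ := k.lastIndex + 1

/-- A Feynman graph of the orientable complex model, with vertex set `V` and set of internal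
lines `L`. The fields of a vertex are numbered from `0` in their cyclic order; the fields of even
number are `φ̄` and those of odd number are `φ`. Every internal line contracts a `φ̄` with a `φ`,
and every field belongs to at most one line. Tadpoles and multiple lines are allowed. -/
structure FeynmanGraph (V L : Type) where
  kind : V → VertexKind
  barEnd : L → (v : V) × Fin (kind v).valence
  phiEnd : L → (v : V) × Fin (kind v).valence
  barEnd_even : ∀ l, Even ((barEnd l).2 : ℕ)
  phiEnd_odd : ∀ l, Odd ((phiEnd l).2 : ℕ)
  barEnd_injective : Function.Injective barEnd
  phiEnd_injective : Function.Injective phiEnd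

namespace FeynmanGraph

variable {V L : Type} (G : FeynmanGraph V L)

/-- The fields (half-lines) of the graph. -/
abbrev Field : Type := (v : V) × Fin (G.kind v).valence

/-- The external fields: those that belong to no internal line. -/
abbrev ExternalField : Type := {f : G.Field // ∀ l, G.barEnd l ≠ f ∧ G.phiEnd l ≠ f}

/-- The graph on all the vertices that is spanned by a set `S` of lines. -/
def lineGraph (S : Set L) : SimpleGraph V :=
  SimpleGraph.fromRel fun v w => ∃ l ∈ S, (G.barEnd l).1 = v ∧ (G.phiEnd l).1 = w

/-- The graph is connected (in particular it has a vertex). -/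
def Connected : Prop := (G.lineGraph Set.univ).Connected

/-! ### Scales -/

/-- The lines of the subgraph `G^i`, those of scale at least `i`. -/
def highLines (μ : L → ℕ) (i : ℕ) : Set L := {l | i ≤ μ l}

/-- The connected components of `G^i`. As `G^i` consists of lines, an isolated vertex is not
a component of it. -/
abbrev Component (μ : L → ℕ) (i : ℕ) : Type :=
  {c : (G.lineGraph (highLines μ i)).ConnectedComponent //
    ∃ l ∈ highLines μ i, (G.barEnd l).1 ∈ c.supp}

/-- The lines of a connected component `G^i_k`. -/
def Component.lines {G : FeynmanGraph V L} {μ : L → ℕ} {i : ℕ} (c : G.Component μ i) : Set L :=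
  {l | l ∈ highLines μ i ∧ (G.barEnd l).1 ∈ c.1.supp}

/-- `N`: the number of external fields of the subgraph with vertex set `W` and line set `S`,
that is, of the fields at `W` that belong to no line in `S`. -/
def externalCount (W : Set V) (S : Set L) : ℕ :=
  {f : G.Field | f.1 ∈ W ∧ ∀ l ∈ S, G.barEnd l ≠ f ∧ G.phiEnd l ≠ f}.ncard

/-- `n₄`: the number of four-point vertices in `W`. -/
def fourCount (W : Set V) : ℕ := {v ∈ W | G.kind v = VertexKind.phi4}.ncard

/-- The convergence degree `ω = N / 2 + n₄ - 3` of the subgraph with vertex set `W` and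
line set `S`. -/
def omega (W : Set V) (S : Set L) : ℝ :=
  (G.externalCount W S : ℝ) / 2 + (G.fourCount W : ℝ) - 3

/-- The product of `M ^ (-ω(G^i_k))` over all scales `i ≥ 1` and all connected components `G^i_k`
of `G^i` (there are none for `i` above the largest scale). -/
def powerCounting [Fintype L] (M : ℝ) (μ : L → ℕ) : ℝ :=
  ∏ i ∈ Finset.Icc 1 (Finset.univ.sup μ),
    ∏ᶠ c : G.Component μ i, M ^ (-G.omega c.1.supp c.lines)

end FeynmanGraph

/-! ### Propagators -/

/-- The range of the Schwinger parameter `α` in the slice `i`: `[1, ∞)` for `i = 0` and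
`[M^(-2i), M^(-2(i-1))]` for `i ≥ 1`. -/
def sliceRange (M : ℝ) (i : ℕ) : Set ℝ :=
  if i = 0 then Set.Ici 1 else Set.Icc (M ^ (-2 * (i : ℤ))) (M ^ (-2 * ((i : ℤ) - 1)))

/-- The integrand in `α` of the propagator, in the short variables `u`, `u₀` and the long
variable `v`, for the frequency `Ω` and the mass `m`. -/
def propagatorIntegrand (Ω m : ℝ) (u : Plane) (u₀ : ℝ) (v : Plane) (α : ℝ) : ℝ :=
  Real.sqrt Ω * α ^ (-(1 / 2) : ℝ) / (2 * Real.sqrt (2 * Real.pi) ^ 3 * Real.sinh α) *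
    Real.exp (-(Ω / 4) * (Real.cosh (α / 2) / Real.sinh (α / 2)) * ‖u‖ ^ 2
      - Ω / 4 * Real.tanh (α / 2) * ‖v‖ ^ 2
      - m ^ 2 / (2 * Ω) * α
      - Ω / (2 * α) * u₀ ^ 2)

/-- The slice `C^i(u, u₀, v)` of the propagator. -/
def propagatorSlice (Ω m M : ℝ) (i : ℕ) (u : Plane) (u₀ : ℝ) (v : Plane) : ℝ :=
  ∫ α in sliceRange M i, propagatorIntegrand Ω m u u₀ v α

/-! ### Vertices -/

/-- The antisymmetric form `x θ⁻¹ y = (2 / θ) (x₁ y₂ - x₂ y₁)`. -/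
def thetaForm (θ : ℝ) (x y : Plane) : ℝ := 2 / θ * (x 0 * y 1 - x 1 * y 0)

/-- The oscillation `exp (i ∑_{i<j} (-1)^(i+j+1) x_i θ⁻¹ x_j)` of a vertex. -/
def vertexPhase (θ : ℝ) {k : ℕ} (x : Fin k → Plane) : ℂ :=
  Complex.exp (Complex.I *
    ((∑ i : Fin k, ∑ j ∈ Finset.Ioi i,
      (-1) ^ ((i : ℕ) + (j : ℕ) + 1) * thetaForm θ (x i) (x j) : ℝ) : ℂ))

/-- All the positions at a vertex, from the positions of all its fields but the last. The last
position is the one at which `x_0 - x_1 + x_2 - ⋯ - x_k` vanishes (`k` is odd). Integrating over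
`y` therefore is integrating over all positions against the `δ` function of the vertex. -/
def vertexPositions {k : ℕ} (y : Fin k → Plane) : Fin (k + 1) → Plane :=
  Fin.snoc y (∑ j : Fin k, (-1 : ℝ) ^ (j : ℕ) • y j)

theorem sum_vertexPositions {k : ℕ} (hk : Odd k) (y : Fin k → Plane) :
    ∑ j : Fin (k + 1), (-1 : ℝ) ^ (j : ℕ) • vertexPositions y j = 0 := by
  simp [vertexPositions, Fin.sum_univ_castSucc, hk.neg_one_pow]

/-! ### Amplitudes -/

namespace FeynmanGraph

variable {V L : Type} (G : FeynmanGraph V L)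

/-- The integration variables of an amplitude: at every vertex the positions in the plane of all
fields but the last, and one commuting coordinate for every vertex. -/
abbrev Config : Type := ((v : V) → Fin (G.kind v).lastIndex → Plane) × (V → ℝ)

/-- The position of a field in the plane. -/
def pos (p : G.Config) (f : G.Field) : Plane := vertexPositions (p.1 f.1) f.2

/-- The commuting coordinate of a field, which is that of its vertex. -/
def pos₀ (p : G.Config) (f : G.Field) : ℝ := p.2 f.1

/-- The integrand of the amputated amplitude of `G` for the scale assignment `μ`, where the
arguments of every external field `e` are smeared against the test function `F e`. -/
def slicedIntegrand [Fintype V] [Fintype L] [Fintype G.ExternalField] (θ Ω m M : ℝ)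
    (F : G.ExternalField → 𝓢(Plane × ℝ, ℂ)) (μ : L → ℕ) (p : G.Config) : ℂ :=
  (∏ v : V, vertexPhase θ fun j => G.pos p ⟨v, j⟩) *
  (∏ l : L, (propagatorSlice Ω m M (μ l)
      (G.pos p (G.barEnd l) - G.pos p (G.phiEnd l))
      (G.pos₀ p (G.barEnd l) - G.pos₀ p (G.phiEnd l))
      (G.pos p (G.barEnd l) + G.pos p (G.phiEnd l)) : ℂ)) *
  ∏ e : G.ExternalField, F e (G.pos p e.1, G.pos₀ p e.1)

/-- The sliced amplitude `A_{G,μ}`, smeared against the test functions `F`. -/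
def slicedAmplitude [Fintype V] [Fintype L] [Fintype G.ExternalField] (θ Ω m M : ℝ)
    (F : G.ExternalField → 𝓢(Plane × ℝ, ℂ)) (μ : L → ℕ) : ℂ :=
  ∫ p : G.Config, G.slicedIntegrand θ Ω m M F μ p

end FeynmanGraph

end NCPhi6

end

/-!
The oscillating phases have absolute value one, so it suffices to integrate the absolute value of
the integrand, which is a product over lines and external fields.

A line of scale `i` has a propagator of size `M ^ i`, with decay at the scale `M ^ (-i)` in
the short variable `u` of the plane and in the difference `u₀` of the commuting coordinates, and at
the scale `M ^ i` in the long variable `v` (`NCPhi6.exists_abs_propagatorSlice_le`). Choose a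
spanning tree rooted at a vertex with an external field. The `δ` function of each vertex is used to
eliminate one position: that of the external field at the root, and elsewhere that of the end of
the line to the parent. A line of the tree then costs `M ^ i` for its size, `M ^ (-2 * i)`
for the integral over `u` and `M ^ (-i)` for the one over `u₀`, which is `M ^ (-2 * i)`
altogether. A loop line costs `M ^ i`, as the integrals over its two ends, one decaying at the long
scale and the other one relative to it at the short scale, compensate. In the plane
this is `NCPhi6.FeynmanGraph.ExitFields.lintegral_prod_planeFactor_eq`, for the commuting
coordinates `NCPhi6.FeynmanGraph.ScaleTree.lintegral_prod_decay_eq`; both rest on a Tonelli theorem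
for triangular changes of variables, `NCPhi6.lintegral_prod_sub_of_triangular`, so that no
determinant has to be computed. The order of integration that makes the change of
variables triangular comes from the tree.

The total is `M ^ (∑ i_l)`, over all lines, times `M ^ (-3 * ∑ i_l)`, over the lines of the tree.
If the tree is grown by Prim's algorithm, always along a line of the largest scale
(`NCPhi6.FeynmanGraph.ScaleTree`), its lines of scale at least `i` span every component of `G^i`.
Distributing the powers over the scales, a component with `n` vertices and `L` lines gets the
exponent `L - 3 * (n - 1)`, which is `-ω` because counting half-lines gives
`2 * L + N = 6 * n - 2 * n₄` (`NCPhi6.FeynmanGraph.ScaleTree.prod_le_powerCounting`).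
-/

namespace NCPhi6

open scoped ENNReal

/-! ### Triangular changes of variables -/

/-- Tonelli for a triangular change of variables: each variable is shifted by a function of the
variables of larger rank only, so the integrals may be done in the order of increasing rank. -/
theorem lintegral_prod_sub_of_triangular {ι E α : Type*} [Fintype ι] [LinearOrder α]
    [AddGroup E] [MeasureSpace E] [MeasurableAdd E] [MeasurableSub₂ E]
    [SigmaFinite (volume : Measure E)] [(volume : Measure E).IsAddRightInvariant]
    (rank : ι → α) (g : ι → E → ℝ≥0∞) (hg : ∀ i, Measurable (g i))
    (c : ι → (ι → E) → E) (hc : ∀ i, Measurable (c i))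
    (hdep : ∀ i x y, (∀ j, rank i < rank j → x j = y j) → c i x = c i y) :
    ∫⁻ x : ι → E, ∏ i, g i (x i - c i x) = ∏ i, ∫⁻ t, g i t := by
  classical
  have hmeas : ∀ s : Finset ι, Measurable fun x : ι → E => ∏ i ∈ s, g i (x i - c i x) := fun s =>
    Finset.measurable_fun_prod s fun i _ => (hg i).comp ((measurable_pi_apply i).sub (hc i))
  have key : ∀ s : Finset ι,
      (∫⋯∫⁻_s, fun x : ι → E => ∏ i ∈ s, g i (x i - c i x)) =
        fun _ => ∏ i ∈ s, ∫⁻ t, g i t := by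
    intro s
    induction s using Finset.induction_on_min_value rank with
    | empty => simp
    | insert a s ha hmin ih =>
      -- `a` has minimal rank, so no shift that is left depends on its variable
      rw [lmarginal_insert' _ (hmeas _) ha]
      have hinner : (fun x : ι → E => ∫⁻ t, ∏ i ∈ insert a s,
            g i (Function.update x a t i - c i (Function.update x a t))) =
          fun x => (∫⁻ t, g a t) * ∏ i ∈ s, g i (x i - c i x) := by
        funext x
        have hca : ∀ t, c a (Function.update x a t) = c a x := fun t =>
          hdep a _ _ fun j hj => Function.update_of_ne (fun h => by simp [h] at hj) _ _
        have hci : ∀ t, ∀ i ∈ s, g i (Function.update x a t i - c i (Function.update x a t)) =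
            g i (x i - c i x) := by
          intro t i hi
          have hia : i ≠ a := fun h => ha (h ▸ hi)
          rw [Function.update_of_ne hia, hdep i (Function.update x a t) x]
          exact fun j hj => Function.update_of_ne
            (fun h => absurd (hmin i hi) (not_le.2 (by rwa [h] at hj))) _ _
        simp_rw [Finset.prod_insert ha]
        rw [← lintegral_sub_right_eq_self (fun t => g a t) (c a x), ← lintegral_mul_const]
        · refine lintegral_congr fun t => ?_
          rw [Finset.prod_congr rfl (hci t), hca, Function.update_self]
        · exact (hg a).comp (measurable_id.sub_const _)
      rw [hinner]
      funext x
      have h2 := congrFun ih x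
      simp only [lmarginal] at h2 ⊢
      rw [lintegral_const_mul, h2, Finset.prod_insert ha]
      exact (hmeas s).comp measurable_updateFinset
  have h := key Finset.univ
  rw [lmarginal_univ] at h
  rw [volume_pi]
  rcases isEmpty_or_nonempty (ι → E) with hE | ⟨⟨x⟩⟩
  · rcases isEmpty_or_nonempty ι with hι | hι
    · exact hE.elim fun i => (hι.false i).elim
    · obtain ⟨i, hi⟩ := isEmpty_pi.1 hE
      have : (volume : Measure E) = 0 := Measure.eq_zero_of_isEmpty _
      rw [lintegral_of_isEmpty, Finset.prod_eq_zero (Finset.mem_univ i)]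
      rw [this, lintegral_zero_measure]
  · exact congrFun h x

/-- Replacing one variable by itself up to a sign, plus a function of the other variables,
preserves Lebesgue measure. -/
theorem measurePreserving_update_shear {ι E : Type*} [Fintype ι] [DecidableEq ι]
    [AddCommGroup E] [Module ℝ E]
    [MeasureSpace E] [MeasurableAdd₂ E] [MeasurableNeg E]
    [MeasurableConstSMul ℝ E]
    [SigmaFinite (volume : Measure E)] [(volume : Measure E).IsAddRightInvariant]
    [(volume : Measure E).IsNegInvariant]
    (i : ι) (ε : ℝ) (hε : ε = 1 ∨ ε = -1) (c : (ι → E) → E) (hc : Measurable c)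
    (hdep : ∀ x t, c (Function.update x i t) = c x) :
    MeasurePreserving (fun x : ι → E => Function.update x i (ε • x i + c x)) := by
  have hm : Measurable fun x : ι → E => Function.update x i (ε • x i + c x) :=
    measurable_update'.comp
      (measurable_id.prodMk (((measurable_pi_apply i).const_smul ε).add hc))
  refine ⟨hm, Measure.ext_of_lintegral _ fun f hf => ?_⟩
  rw [lintegral_map hf hm, volume_pi]
  refine lintegral_eq_of_lmarginal_eq {i} (hf.comp hm) hf ?_
  rw [lmarginal_singleton, lmarginal_singleton]
  funext x
  simp only [Function.update_self, Function.update_idem, hdep]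
  rcases hε with rfl | rfl
  · simpa using lintegral_add_right_eq_self (fun t => f (Function.update x i t)) (c x)
  · simp only [neg_smul, one_smul]
    rw [lintegral_neg_eq_self (fun t => f (Function.update x i (t + c x)))]
    exact lintegral_add_right_eq_self (fun t => f (Function.update x i t)) (c x)

/-- Lebesgue measure on a product of products is Lebesgue measure on the product over pairs. -/
theorem measurePreserving_sigmaUncurry {ι E : Type*} {κ : ι → Type*} [Fintype ι]
    [∀ i, Fintype (κ i)] [MeasureSpace E] [SigmaFinite (volume : Measure E)] :
    MeasurePreserving (fun (y : (i : ι) → κ i → E) (p : (i : ι) × κ i) => y p.1 p.2) := by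
  have hm : Measurable fun (y : (i : ι) → κ i → E) (p : (i : ι) × κ i) => y p.1 p.2 := by
    fun_prop
  refine ⟨hm, ?_⟩
  rw [volume_pi (α := fun _ : (i : ι) × κ i => E)]
  refine (Measure.pi_eq fun s hs => ?_).symm
  rw [Measure.map_apply hm (MeasurableSet.univ_pi hs)]
  have : (fun (y : (i : ι) → κ i → E) (p : (i : ι) × κ i) => y p.1 p.2) ⁻¹' Set.univ.pi s =
      Set.univ.pi fun i => Set.univ.pi fun j => s ⟨i, j⟩ := by
    ext y
    simp only [Set.mem_preimage, Set.mem_pi, Set.mem_univ, true_implies]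
    exact ⟨fun h i j => h ⟨i, j⟩, fun h p => h p.1 p.2⟩
  rw [this, volume_pi_pi, Fintype.prod_sigma]
  simp_rw [volume_pi_pi]

/-! ### A decay function -/

/-- The function `(1 + ‖x‖) ^ (-3)`, which is integrable in dimensions one and two. It bounds all
propagators and test functions, as nothing but integrability and scaling matter. -/
noncomputable def decay {E : Type*} [Norm E] (x : E) : ℝ := ((1 + ‖x‖) ^ 3)⁻¹

section decay

variable {E : Type*} [NormedAddCommGroup E]

theorem decay_pos (x : E) : 0 < decay x := by unfold decay; positivity

theorem decay_le_one (x : E) : decay x ≤ 1 :=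
  inv_le_one_of_one_le₀ (one_le_pow₀ (by linarith [norm_nonneg x]))

theorem decay_neg (x : E) : decay (-x) = decay x := by simp [decay]

theorem continuous_decay : Continuous (decay : E → ℝ) := by
  unfold decay
  exact Continuous.inv₀ (by fun_prop) fun x => by positivity

variable [NormedSpace ℝ E]

/-- Decay of `u` at the scale `s` and of `v` at the scale `s⁻¹` implies decay at the scale `s⁻¹`
of their mean `x`. -/
theorem decay_mul_decay_le {s : ℝ} (hs : 1 ≤ s) {u v x : E} (h : (2 : ℝ) • x = u + v) :
    decay (s • u) * decay (s⁻¹ • v) ≤ decay (s⁻¹ • x) := by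
  have hs0 : 0 < s := by linarith
  unfold decay
  rw [← mul_inv, ← mul_pow]
  refine inv_anti₀ (by positivity) (pow_le_pow_left₀ (by positivity) ?_ 3)
  simp only [norm_smul, norm_inv, Real.norm_eq_abs, abs_of_pos hs0]
  have h1 : 2 * ‖x‖ ≤ ‖u‖ + ‖v‖ := by
    have := norm_add_le u v
    rw [← h, norm_smul] at this
    simpa using this
  have h2 : s⁻¹ ≤ s := (inv_le_one_of_one_le₀ hs).trans hs
  have h3 : s⁻¹ * ‖u‖ ≤ s * ‖u‖ := by gcongr
  have h4 : s⁻¹ * (2 * ‖x‖) ≤ s⁻¹ * (‖u‖ + ‖v‖) := by gcongr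
  have h5 : 0 ≤ s * ‖u‖ * (s⁻¹ * ‖v‖) := by positivity
  have h6 : 0 ≤ s⁻¹ * ‖x‖ := by positivity
  nlinarith

variable [FiniteDimensional ℝ E] [MeasureSpace E] [BorelSpace E]
  [(volume : Measure E).IsAddHaarMeasure]

theorem integrable_decay (hE : Module.finrank ℝ E ≤ 2) : Integrable (decay : E → ℝ) := by
  have h : (Module.finrank ℝ E : ℝ) < 3 := by
    have : (Module.finrank ℝ E : ℝ) ≤ 2 := by exact_mod_cast hE
    linarith
  refine (integrable_one_add_norm (μ := volume) h).congr (Filter.Eventually.of_forall fun x => ?_)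
  simp only [decay]
  rw [Real.rpow_neg (by positivity)]
  norm_cast

theorem lintegral_decay_smul (hE : Module.finrank ℝ E ≤ 2) {s : ℝ} (hs : 0 < s) :
    ∫⁻ x : E, ENNReal.ofReal (decay (s • x)) =
      ENNReal.ofReal ((s ^ Module.finrank ℝ E)⁻¹ * ∫ x : E, decay x) := by
  rw [← ofReal_integral_eq_lintegral_ofReal ((integrable_decay hE).comp_smul hs.ne')
    (Filter.Eventually.of_forall fun x => (decay_pos _).le), Measure.integral_comp_smul,
    abs_of_pos (by positivity), smul_eq_mul]

end decay

/-! ### Bounds on the propagator -/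

/-- A Gaussian is bounded by the square of the decay function. -/
theorem exists_exp_neg_mul_sq_le_decay_sq {c : ℝ} (hc : 0 < c) :
    ∃ C : ℝ, 1 ≤ C ∧ ∀ (E : Type) [NormedAddCommGroup E] (x : E),
      Real.exp (-(c * ‖x‖ ^ 2)) ≤ C * decay x ^ 2 := by
  -- the cube of `(1 + t) ^ 2 ≤ 2 * (1 + 3 / c) * exp (c * t ^ 2 / 3)`, where `t = ‖x‖`
  refine ⟨8 * (1 + 3 / c) ^ 3, ?_, fun E _ x => ?_⟩
  · have : (1 : ℝ) ≤ (1 + 3 / c) ^ 3 := one_le_pow₀ (by linarith [div_pos (zero_lt_three' ℝ) hc])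
    linarith
  · set t := ‖x‖
    have ht : 0 ≤ t := norm_nonneg x
    have h1 : (1 + t) ^ 2 ≤ 2 * (1 + 3 / c) * Real.exp (c * t ^ 2 / 3) := by
      have h2 := Real.add_one_le_exp (c * t ^ 2 / 3)
      have h3 : (1 + t) ^ 2 ≤ 2 * (1 + t ^ 2) := by nlinarith [sq_nonneg (1 - t)]
      have h4 : 1 + t ^ 2 ≤ (1 + 3 / c) * (c * t ^ 2 / 3 + 1) := by
        have : (1 + 3 / c) * (c * t ^ 2 / 3 + 1) = 1 + t ^ 2 + c * t ^ 2 / 3 + 3 / c := by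
          field_simp; ring
        rw [this]; have : 0 ≤ c * t ^ 2 / 3 + 3 / c := by positivity
        linarith
      have h5 : (1 + 3 / c) * (c * t ^ 2 / 3 + 1) ≤ (1 + 3 / c) * Real.exp (c * t ^ 2 / 3) := by
        gcongr
      linarith
    have h6 : (1 + t) ^ 6 ≤ 8 * (1 + 3 / c) ^ 3 * Real.exp (c * t ^ 2) := by
      calc (1 + t) ^ 6 = ((1 + t) ^ 2) ^ 3 := by ring
        _ ≤ (2 * (1 + 3 / c) * Real.exp (c * t ^ 2 / 3)) ^ 3 := by gcongr
        _ = 8 * (1 + 3 / c) ^ 3 * Real.exp (c * t ^ 2) := by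
          rw [mul_pow, ← Real.exp_nat_mul]; push_cast; ring_nf
    have h7 : decay x ^ 2 = ((1 + t) ^ 6)⁻¹ := by simp only [decay]; rw [inv_pow]; ring_nf; rfl
    rw [h7, ← div_eq_mul_inv, le_div_iff₀ (by positivity), Real.exp_neg,
      inv_mul_le_iff₀ (by positivity)]
    linarith

theorem sinh_le_and_cosh_le {x : ℝ} (h0 : 0 ≤ x) (h1 : x ≤ 1 / 2) :
    Real.sinh x ≤ 2 * x ∧ Real.cosh x ≤ 2 := by
  have h2 := Real.add_one_le_exp (-x)
  have h3 : Real.exp x * Real.exp (-x) = 1 := by rw [← Real.exp_add]; simp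
  have h4 : Real.exp (-x) ≤ 1 := Real.exp_le_one_iff.2 (by linarith)
  have h5 : Real.exp x * (1 - x) ≤ 1 := by
    nlinarith [Real.exp_pos x]
  rw [Real.sinh_eq, Real.cosh_eq]
  constructor
  · nlinarith [Real.exp_pos x]
  · nlinarith [Real.exp_pos x]

/-- Near `0`, which is the range of the slices of positive scale, `coth x` and `tanh x` are at least
of the order of `x⁻¹` and `x`. -/
theorem coth_tanh_lower_of_le {x : ℝ} (h0 : 0 < x) (h1 : x ≤ 1 / 2) :
    (2 * x)⁻¹ ≤ Real.cosh x / Real.sinh x ∧ x / 2 ≤ Real.tanh x := by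
  obtain ⟨h2, h3⟩ := sinh_le_and_cosh_le h0.le h1
  have hs : 0 < Real.sinh x := Real.sinh_pos_iff.2 h0
  have hc := Real.one_le_cosh x
  constructor
  · rw [le_div_iff₀ hs, inv_mul_le_iff₀ (by positivity)]
    nlinarith
  · rw [Real.tanh_eq_sinh_div_cosh, le_div_iff₀ (by positivity)]
    have := Real.self_le_sinh_iff.2 h0.le
    nlinarith

/-- Away from `0`, which is the range of the slice of scale `0`, `coth x` and `tanh x` are bounded
below. -/
theorem coth_tanh_lower_of_ge {x : ℝ} (h1 : 1 / 2 ≤ x) :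
    1 ≤ Real.cosh x / Real.sinh x ∧ 1 / 3 ≤ Real.tanh x := by
  have hs : 0 < Real.sinh x := Real.sinh_pos_iff.2 (by linarith)
  have hc := Real.one_le_cosh x
  constructor
  · rw [le_div_iff₀ hs]; linarith [Real.sinh_lt_cosh x]
  · rw [Real.tanh_eq_sinh_div_cosh, le_div_iff₀ (by positivity)]
    have h2 := Real.add_one_le_exp (2 * x)
    have h3 : Real.exp x * Real.exp (-x) = 1 := by rw [← Real.exp_add]; simp
    have h4 : Real.exp (2 * x) * Real.exp (-x) = Real.exp x := by rw [← Real.exp_add]; ring_nf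
    rw [Real.sinh_eq, Real.cosh_eq]
    nlinarith [Real.exp_pos (-x)]

theorem propagatorIntegrand_nonneg {Ω : ℝ} (m : ℝ) (u : Plane) (u₀ : ℝ) (v : Plane)
    {α : ℝ} (hα : 0 < α) : 0 ≤ propagatorIntegrand Ω m u u₀ v α := by
  have := Real.sinh_pos_iff.2 hα
  unfold propagatorIntegrand
  positivity

/-- The part of the bound on the propagator that is common to all slices: only lower bounds for the
rates of decay `coth (α / 2)` and `tanh (α / 2)` enter. -/
theorem propagatorIntegrand_le {Ω a C : ℝ} (hΩ : 0 < Ω) (m : ℝ)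
    (hC : 1 ≤ C)
    (hexp : ∀ (E : Type) [NormedAddCommGroup E] (x : E),
      Real.exp (-(Ω * a / 4 * ‖x‖ ^ 2)) ≤ C * decay x ^ 2)
    {s : ℝ} {α : ℝ} (hα : 0 < α)
    (hcoth : a * s ^ 2 ≤ Real.cosh (α / 2) / Real.sinh (α / 2))
    (htanh : a * s⁻¹ ^ 2 ≤ Real.tanh (α / 2))
    (u : Plane) (u₀ : ℝ) (v : Plane) :
    propagatorIntegrand Ω m u u₀ v α ≤
      Real.sqrt Ω / (2 * Real.sqrt (2 * Real.pi) ^ 3) * (α ^ (-(1 / 2) : ℝ) / Real.sinh α) *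
        (C ^ 2 * (decay (s • u) ^ 2 * decay (s⁻¹ • v))) * Real.exp (-(Ω / 2) * (u₀ ^ 2 / α)) := by
  have hsinh := Real.sinh_pos_iff.2 hα
  have h1 : -(Ω / 4) * (Real.cosh (α / 2) / Real.sinh (α / 2)) * ‖u‖ ^ 2
      - Ω / 4 * Real.tanh (α / 2) * ‖v‖ ^ 2 - m ^ 2 / (2 * Ω) * α - Ω / (2 * α) * u₀ ^ 2 ≤
      -(Ω * a / 4 * ‖s • u‖ ^ 2) + -(Ω * a / 4 * ‖s⁻¹ • v‖ ^ 2) + -(Ω / 2) * (u₀ ^ 2 / α) := by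
    have e1 : ‖s • u‖ ^ 2 = s ^ 2 * ‖u‖ ^ 2 := by
      rw [norm_smul, mul_pow, Real.norm_eq_abs, sq_abs]
    have e2 : ‖s⁻¹ • v‖ ^ 2 = s⁻¹ ^ 2 * ‖v‖ ^ 2 := by
      rw [norm_smul, mul_pow, Real.norm_eq_abs, sq_abs]
    have e3 : -(Ω / 2) * (u₀ ^ 2 / α) = - (Ω / (2 * α) * u₀ ^ 2) := by field_simp
    have i1 : Ω / 4 * (a * s ^ 2) * ‖u‖ ^ 2 ≤
        Ω / 4 * (Real.cosh (α / 2) / Real.sinh (α / 2)) * ‖u‖ ^ 2 := by gcongr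
    have i2 : Ω / 4 * (a * s⁻¹ ^ 2) * ‖v‖ ^ 2 ≤ Ω / 4 * Real.tanh (α / 2) * ‖v‖ ^ 2 := by gcongr
    have i3 : 0 ≤ m ^ 2 / (2 * Ω) * α := by positivity
    rw [e1, e2, e3]
    nlinarith
  have h2 : Real.exp (-(Ω * a / 4 * ‖s⁻¹ • v‖ ^ 2)) ≤ C * decay (s⁻¹ • v) := by
    refine (hexp Plane (s⁻¹ • v)).trans ?_
    have := decay_le_one (s⁻¹ • v)
    have h0 := decay_pos (s⁻¹ • v)
    gcongr
    nlinarith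
  unfold propagatorIntegrand
  calc _ ≤ Real.sqrt Ω * α ^ (-(1 / 2) : ℝ) / (2 * Real.sqrt (2 * Real.pi) ^ 3 * Real.sinh α) *
        (C * decay (s • u) ^ 2 * (C * decay (s⁻¹ • v)) * Real.exp (-(Ω / 2) * (u₀ ^ 2 / α))) := by
        refine mul_le_mul_of_nonneg_left ((Real.exp_le_exp.2 h1).trans ?_) (by positivity)
        rw [Real.exp_add, Real.exp_add]
        have := hexp Plane (s • u)
        have h0 := decay_pos (s⁻¹ • v)
        gcongr
    _ = _ := by field_simp

/-- The slice `i` of the propagator is of size `M ^ i`, with decay at the scale `M ^ (-i)` in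
the short variables and at the scale `M ^ i` in the long variable. -/
theorem exists_abs_propagatorSlice_le {Ω M : ℝ} (m : ℝ) (hΩ : 0 < Ω) (hM : 1 < M) :
    ∃ K : ℝ, 1 ≤ K ∧ ∀ (i : ℕ) (u : Plane) (u₀ : ℝ) (v : Plane),
      |propagatorSlice Ω m M i u u₀ v| ≤ K * M ^ i *
        (decay (M ^ i • u) ^ 2 * decay ((M ^ i)⁻¹ • v) * decay (M ^ i • u₀)) := by
  have hM0 : 0 < M := by linarith
  set a : ℝ := 1 / (4 * M ^ 2) with ha_def
  have ha : 0 < a := by positivity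
  have hM2 : 1 ≤ M ^ 2 := one_le_pow₀ hM.le
  have ha4 : a ≤ 1 / 4 := by
    rw [ha_def, div_le_div_iff₀ (by positivity) (by norm_num)]; linarith
  obtain ⟨C, hC, hexp⟩ := exists_exp_neg_mul_sq_le_decay_sq (c := Ω * a / 4) (by positivity)
  set A : ℝ := Real.sqrt Ω / (2 * Real.sqrt (2 * Real.pi) ^ 3) with hA
  have hA0 : 0 < A := by positivity
  set I : ℝ := ∫ α in Set.Ici (1 : ℝ), 8 * Real.exp (-(1 / 2) * α) with hI
  have hI0 : 0 ≤ I := integral_nonneg fun _ => by positivity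
  have hexp1 : ∀ x : ℝ, Real.exp (-(Ω * a / 4 * x ^ 2)) ≤ C * decay x := by
    intro x
    have h := hexp ℝ x
    rw [Real.norm_eq_abs, sq_abs] at h
    refine h.trans ?_
    have := decay_le_one x
    have h0 := decay_pos x
    gcongr
    nlinarith
  refine ⟨A * C ^ 3 * (M ^ 2 + I) + 1, by
    have : 0 ≤ A * C ^ 3 * (M ^ 2 + I) := by positivity
    linarith, fun i u u₀ v => ?_⟩
  set D := decay (M ^ i • u) ^ 2 * decay ((M ^ i)⁻¹ • v) * decay (M ^ i • u₀) with hD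
  have hDu := decay_pos (M ^ i • u)
  have hDv := decay_pos ((M ^ i)⁻¹ • v)
  have hDt := decay_pos (M ^ i • u₀)
  have hD0 : 0 < D := by positivity
  have hs : 1 ≤ M ^ i := one_le_pow₀ hM.le
  suffices h : |propagatorSlice Ω m M i u u₀ v| ≤ A * C ^ 3 * (M ^ 2 + I) * M ^ i * D by
    refine h.trans ?_
    gcongr
    linarith
  unfold propagatorSlice sliceRange
  rw [← Real.norm_eq_abs]
  rcases Nat.eq_zero_or_pos i with rfl | hi
  · simp only [if_true]
    have hint : IntegrableOn (fun α : ℝ => A * C ^ 3 * D * (8 * Real.exp (-(1 / 2) * α)))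
        (Set.Ici 1) := by
      rw [integrableOn_Ici_iff_integrableOn_Ioi]
      exact ((integrableOn_exp_mul_Ioi (by norm_num) 1).const_mul 8).const_mul _
    refine (norm_integral_le_of_norm_le hint ?_).trans ?_
    · refine (ae_restrict_iff' measurableSet_Ici).2 (Filter.Eventually.of_forall fun α hα => ?_)
      have hα1 : 1 ≤ α := hα
      have hα0 : 0 < α := by linarith
      rw [Real.norm_of_nonneg (propagatorIntegrand_nonneg m u u₀ v hα0)]
      obtain ⟨hc, ht⟩ := coth_tanh_lower_of_ge (x := α / 2) (by linarith)
      have hb := propagatorIntegrand_le (s := M ^ 0) hΩ m hC hexp hα0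
        (by simp; linarith) (by simp; linarith) u u₀ v
      refine hb.trans ?_
      have hsinh := Real.sinh_pos_iff.2 hα0
      -- the loss of `α ^ (3 / 2)` in the commuting variable is paid by the decay of `(sinh α)⁻¹`
      have hu0 : Real.exp (-(Ω / 2) * (u₀ ^ 2 / α)) ≤
          C * (α ^ (3 / 2 : ℝ) * decay (M ^ 0 • u₀)) := by
        have hsq : Real.sqrt α ^ 2 = α := Real.sq_sqrt hα0.le
        have hr : 1 ≤ Real.sqrt α := Real.one_le_sqrt.2 hα1
        have h1 : Real.exp (-(Ω / 2) * (u₀ ^ 2 / α)) ≤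
            Real.exp (-(Ω * a / 4 * (u₀ / Real.sqrt α) ^ 2)) := by
          rw [div_pow, hsq]
          refine Real.exp_le_exp.2 ?_
          have : 0 ≤ u₀ ^ 2 / α := by positivity
          have : Ω * a / 4 * (u₀ ^ 2 / α) ≤ Ω / 2 * (u₀ ^ 2 / α) := by
            gcongr ?_ * _
            nlinarith
          linarith
        refine (h1.trans (hexp1 _)).trans ?_
        gcongr
        have h2 : α ^ (3 / 2 : ℝ) = Real.sqrt α ^ 3 := by
          rw [Real.sqrt_eq_rpow, ← Real.rpow_natCast, ← Real.rpow_mul hα0.le]; norm_num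
        rw [h2]
        simp only [decay, pow_zero, one_smul]
        rw [← div_eq_mul_inv, ← div_pow, ← inv_pow]
        refine pow_le_pow_left₀ (by positivity) ?_ 3
        rw [norm_div, Real.norm_of_nonneg (Real.sqrt_nonneg α), inv_le_comm₀ (by positivity)
          (by positivity), inv_div, add_div]
        gcongr
        exact (div_le_one₀ (by positivity)).2 hr
      have hα3 : α ^ (-(1 / 2) : ℝ) * α ^ (3 / 2 : ℝ) = α := by
        rw [← Real.rpow_add hα0]; norm_num
      have hsinh2 : α / Real.sinh α ≤ 8 * Real.exp (-(1 / 2) * α) := by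
        rw [div_le_iff₀ hsinh]
        have e1 : Real.exp α = Real.exp (α / 2) * Real.exp (α / 2) := by
          rw [← Real.exp_add]; ring_nf
        have e2 : Real.exp (-(1 / 2) * α) * Real.exp (α / 2) = 1 := by
          rw [← Real.exp_add]; ring_nf; simp
        have e3 := Real.add_one_le_exp (α / 2)
        have e4 : Real.exp (-α) ≤ Real.exp α / 2 := by
          have h1 : Real.exp (-α) * Real.exp α = 1 := by rw [← Real.exp_add]; simp
          have h2 := Real.add_one_le_exp α
          have h3 := Real.exp_pos (-α)
          nlinarith
        have e5 : Real.exp α / 4 ≤ Real.sinh α := by rw [Real.sinh_eq]; linarith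
        have e6 := Real.exp_pos (-(1 / 2) * α)
        calc α ≤ 2 * Real.exp (α / 2) := by linarith
          _ = 8 * Real.exp (-(1 / 2) * α) * (Real.exp α / 4) := by
            rw [e1]; linear_combination (-2 * Real.exp (α / 2)) * e2
          _ ≤ _ := by gcongr
      calc _ ≤ A * (α ^ (-(1 / 2) : ℝ) / Real.sinh α) *
            (C ^ 2 * (decay (M ^ 0 • u) ^ 2 * decay ((M ^ 0)⁻¹ • v))) *
            (C * (α ^ (3 / 2 : ℝ) * decay (M ^ 0 • u₀))) := by gcongr
        _ = A * C ^ 3 * D * ((α ^ (-(1 / 2) : ℝ) * α ^ (3 / 2 : ℝ)) / Real.sinh α) := by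
            rw [hD]; field_simp
        _ ≤ _ := by rw [hα3]; gcongr
    · rw [integral_const_mul, ← hI]
      have : 0 ≤ A * C ^ 3 * D * M ^ 2 := by positivity
      simp only [pow_zero]
      nlinarith
  · simp only [if_neg hi.ne']
    set s := M ^ i with hsdef
    have hs0 : 0 < s := by linarith
    have e1 : M ^ (-2 * (i : ℤ)) = (s ^ 2)⁻¹ := by
      rw [show (-2 * (i : ℤ)) = -((i * 2 : ℕ) : ℤ) by push_cast; ring, zpow_neg, zpow_natCast,
        pow_mul]
    have e2 : M ^ (-2 * ((i : ℤ) - 1)) = M ^ 2 * (s ^ 2)⁻¹ := by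
      rw [show (-2 * ((i : ℤ) - 1)) = 2 + -2 * (i : ℤ) by ring, zpow_add₀ hM0.ne', e1]
      norm_cast
    rw [e1, e2]
    have hsM : M ≤ s := by
      rw [hsdef]; exact le_self_pow₀ hM.le hi.ne'
    have hle1 : M ^ 2 * (s ^ 2)⁻¹ ≤ 1 := by
      rw [← div_eq_mul_inv, div_le_one₀ (by positivity)]; gcongr
    have hbound : ∀ α ∈ Set.Icc ((s ^ 2)⁻¹) (M ^ 2 * (s ^ 2)⁻¹),
        ‖propagatorIntegrand Ω m u u₀ v α‖ ≤ A * C ^ 3 * s ^ 3 * D := by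
      rintro α ⟨h1, h2⟩
      have hα0 : 0 < α := lt_of_lt_of_le (by positivity) h1
      have hα1 : α ≤ 1 := h2.trans hle1
      rw [Real.norm_of_nonneg (propagatorIntegrand_nonneg m u u₀ v hα0)]
      obtain ⟨hc, ht⟩ := coth_tanh_lower_of_le (x := α / 2) (by linarith) (by linarith)
      have hsinv : s⁻¹ ^ 2 = (s ^ 2)⁻¹ := inv_pow _ _
      have hαinv : s ^ 2 / M ^ 2 ≤ α⁻¹ := by
        rw [le_inv_comm₀ (by positivity) hα0, inv_div]; exact h2
      have haM : a * s ^ 2 ≤ s ^ 2 / M ^ 2 := by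
        rw [ha_def, div_mul_eq_mul_div, one_mul]; gcongr; linarith
      have hb := propagatorIntegrand_le (s := s) hΩ m hC hexp hα0
        (by
          refine le_trans ?_ hc
          rw [mul_div_cancel₀ α two_ne_zero]
          exact haM.trans hαinv)
        (by
          refine le_trans ?_ ht
          rw [hsinv]
          have : a * (s ^ 2)⁻¹ ≤ 1 / 4 * α := by gcongr
          linarith) u u₀ v
      refine hb.trans ?_
      have hsinh := Real.sinh_pos_iff.2 hα0
      have hu0 : Real.exp (-(Ω / 2) * (u₀ ^ 2 / α)) ≤ C * decay (s • u₀) := by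
        refine le_trans (Real.exp_le_exp.2 ?_) (hexp1 (s • u₀))
        rw [smul_eq_mul, mul_pow, div_eq_inv_mul (u₀ ^ 2)]
        have : Ω / 4 * (a * s ^ 2) * u₀ ^ 2 ≤ Ω / 2 * α⁻¹ * u₀ ^ 2 := by
          gcongr
          · norm_num
          · exact haM.trans hαinv
        linarith
      have hpre : α ^ (-(1 / 2) : ℝ) / Real.sinh α ≤ s ^ 3 := by
        have h3 : α ^ (-(1 / 2) : ℝ) ≤ s := by
          rw [Real.rpow_neg hα0.le, ← Real.sqrt_eq_rpow, inv_le_comm₀ (by positivity) hs0]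
          refine Real.le_sqrt_of_sq_le ?_
          rw [hsinv]; exact h1
        have h4 : s⁻¹ ^ 2 ≤ Real.sinh α := by
          rw [hsinv]; exact h1.trans (Real.self_le_sinh_iff.2 hα0.le)
        calc α ^ (-(1 / 2) : ℝ) / Real.sinh α ≤ s / s⁻¹ ^ 2 := by gcongr
          _ = s ^ 3 := by field_simp
      calc _ ≤ A * s ^ 3 * (C ^ 2 * (decay (s • u) ^ 2 * decay (s⁻¹ • v))) *
            (C * decay (s • u₀)) := by gcongr
        _ = _ := by rw [hD]; ring
    refine (norm_setIntegral_le_of_norm_le_const (by simp) hbound).trans ?_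
    -- the integrand is of size `s ^ 3` on an interval of length at most `M ^ 2 * s ^ (-2)`
    rw [Real.volume_real_Icc]
    have hvol : max (M ^ 2 * (s ^ 2)⁻¹ - (s ^ 2)⁻¹) 0 ≤ M ^ 2 * (s ^ 2)⁻¹ :=
      max_le (by have : 0 < (s ^ 2)⁻¹ := by positivity
                 linarith) (by positivity)
    calc _ ≤ A * C ^ 3 * s ^ 3 * D * (M ^ 2 * (s ^ 2)⁻¹) := by gcongr
      _ = A * C ^ 3 * M ^ 2 * s * D := by field_simp
      _ ≤ _ := by gcongr; linarith

theorem measurable_propagatorSlice (Ω m M : ℝ) (i : ℕ) :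
    Measurable fun p : Plane × ℝ × Plane => propagatorSlice Ω m M i p.1 p.2.1 p.2.2 := by
  unfold propagatorSlice
  refine (StronglyMeasurable.integral_prod_right
    (f := fun (p : Plane × ℝ × Plane) α => propagatorIntegrand Ω m p.1 p.2.1 p.2.2 α) ?_).measurable
  refine Measurable.stronglyMeasurable ?_
  unfold Function.uncurry propagatorIntegrand
  simp only [Real.tanh_eq_sinh_div_cosh]
  fun_prop

/-- A set of test functions that is bounded in the Schwartz seminorms is dominated by a product
of decay functions. -/
theorem exists_norm_le_decay_mul_decay (𝓕 : Set 𝓢(Plane × ℝ, ℂ))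
    (h𝓕 : ∀ a b : ℕ, ∃ C : ℝ, ∀ f ∈ 𝓕, SchwartzMap.seminorm ℝ a b f ≤ C) :
    ∃ K : ℝ, 1 ≤ K ∧ ∀ f ∈ 𝓕, ∀ (x : Plane) (t : ℝ), ‖f (x, t)‖ ≤ K * (decay x * decay t) := by
  obtain ⟨C₀, h₀⟩ := h𝓕 0 0
  obtain ⟨C₆, h₆⟩ := h𝓕 6 0
  refine ⟨max 1 (2 ^ 5 * (C₀ + C₆)), le_max_left _ _, fun f hf x t => ?_⟩
  have k₀ := (SchwartzMap.norm_pow_mul_le_seminorm ℝ f 0 (x, t)).trans (h₀ f hf)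
  have k₆ := (SchwartzMap.norm_pow_mul_le_seminorm ℝ f 6 (x, t)).trans (h₆ f hf)
  set p : Plane × ℝ := (x, t)
  have hx : ‖x‖ ≤ ‖p‖ := le_max_left _ _
  have ht : ‖t‖ ≤ ‖p‖ := le_max_right _ _
  have h1 : decay x * decay t = ((1 + ‖x‖) ^ 3 * (1 + ‖t‖) ^ 3)⁻¹ := by
    simp only [decay, mul_inv]
  rw [h1, ← div_eq_mul_inv, le_div_iff₀ (by positivity)]
  refine le_trans ?_ (le_max_right _ _)
  have h2 : (1 + ‖x‖) ^ 3 * (1 + ‖t‖) ^ 3 ≤ (1 + ‖p‖) ^ 6 := by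
    calc _ ≤ (1 + ‖p‖) ^ 3 * (1 + ‖p‖) ^ 3 := by gcongr
      _ = _ := by ring
  have h3 : (1 + ‖p‖) ^ 6 ≤ 2 ^ 5 * (1 ^ 6 + ‖p‖ ^ 6) :=
    add_pow_le zero_le_one (norm_nonneg p) 6
  calc ‖f p‖ * ((1 + ‖x‖) ^ 3 * (1 + ‖t‖) ^ 3) ≤ ‖f p‖ * (2 ^ 5 * (1 ^ 6 + ‖p‖ ^ 6)) := by
        exact mul_le_mul_of_nonneg_left (h2.trans h3) (norm_nonneg _)
    _ = 2 ^ 5 * (‖p‖ ^ 0 * ‖f p‖ + ‖p‖ ^ 6 * ‖f p‖) := by ring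
    _ ≤ _ := by gcongr

namespace FeynmanGraph

variable {V L : Type} (G : FeynmanGraph V L)

/-! ### Spanning trees adapted to the scales -/

/-- The line `l` joins the vertices `v` and `w`. -/
def Joins (l : L) (v w : V) : Prop :=
  ((G.barEnd l).1 = v ∧ (G.phiEnd l).1 = w) ∨ ((G.barEnd l).1 = w ∧ (G.phiEnd l).1 = v)

theorem lineGraph_adj_iff {S : Set L} {v w : V} :
    (G.lineGraph S).Adj v w ↔ v ≠ w ∧ ∃ l ∈ S, G.Joins l v w := by
  simp only [lineGraph, SimpleGraph.fromRel_adj, Joins]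
  grind

/-- A spanning tree of a graph, rooted at `r`, as it is grown by Prim's algorithm: the vertices are
attached in the order of their rank, each by the line `line v` to a vertex of lower rank, and
`line v` has the largest scale among the lines that could have been chosen instead. -/
structure ScaleTree (μ : L → ℕ) (r : V) where
  rank : V → ℕ
  rank_injective : Function.Injective rank
  line : {v // v ≠ r} → L
  exists_parent : ∀ v : {v // v ≠ r}, ∃ w, rank w < rank v ∧ G.Joins (line v) v w
  le_of_crossing : ∀ (v : {v // v ≠ r}) (l a b), G.Joins l a b → rank a < rank v → rank v ≤ rank b →
    μ l ≤ μ (line v)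

/-- A walk that leaves a set `s` of vertices does so along a line. -/
theorem exists_joins_of_reachable {S : Set L} {v w : V} (h : (G.lineGraph S).Reachable v w)
    (s : Set V) (hv : v ∈ s) (hw : w ∉ s) : ∃ l ∈ S, ∃ a ∈ s, ∃ b, b ∉ s ∧ G.Joins l a b := by
  obtain ⟨p⟩ := h
  obtain ⟨e, -, he1, he2⟩ := p.exists_boundary_dart s hv hw
  obtain ⟨-, l, hl, hj⟩ := G.lineGraph_adj_iff.1 e.adj
  exact ⟨l, hl, _, he1, _, he2, hj⟩

/-- The first `n` steps of Prim's algorithm; the vertices not yet attached have rank `n`. -/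
theorem exists_partial_scaleTree [Fintype V] [Fintype L] (hG : G.Connected) (μ : L → ℕ) (r : V)
    (n : ℕ) (hn : n + 1 ≤ Fintype.card V) :
    ∃ d : V → ℕ, d r = 0 ∧ (∀ v, d v ≤ n + 1) ∧ (∀ k < n + 1, ∃ v, d v = k) ∧
      (∀ v w, d v = d w → d v < n + 1 → v = w) ∧
      ∀ v, v ≠ r → d v < n + 1 → ∃ l w, d w < d v ∧ G.Joins l v w ∧
        ∀ l' a b, G.Joins l' a b → d a < d v → d v ≤ d b → μ l' ≤ μ l := by
  classical
  induction n with
  | zero =>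
    refine ⟨fun v => if v = r then 0 else 1, by simp,
      fun v => by dsimp only; split_ifs <;> simp, fun k hk => ⟨r, by simp; omega⟩, fun v w => ?_, fun v hv => by simp [hv]⟩
    by_cases hv : v = r <;> by_cases hw : w = r <;> simp [hv, hw]
  | succ n ih =>
    obtain ⟨d, hr, hle, hsurj, hinj, htree⟩ := ih (by omega)
    obtain ⟨v, hv⟩ : ∃ v, d v = n + 1 := by
      by_contra! hne
      have hinj' : Function.Injective d := fun v w h =>
        hinj v w h (lt_of_le_of_ne (hle v) (hne v))
      have := Finset.card_le_card_of_injOn (s := Finset.univ) (t := Finset.range (n + 1)) d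
        (fun v _ => by simpa using lt_of_le_of_ne (hle v) (hne v)) hinj'.injOn
      simp at this
      omega
    obtain ⟨l₀, -, a₀, ha₀, b₀, hb₀, hj₀⟩ := G.exists_joins_of_reachable
      (hG.preconnected r v) {w | d w < n + 1} (by simp [hr]) (by simp [hv])
    obtain ⟨l, hl, hmax⟩ := Finset.exists_max_image
      (Finset.univ.filter fun l => ∃ a b, d a < n + 1 ∧ n + 1 ≤ d b ∧ G.Joins l a b) μ
      ⟨l₀, Finset.mem_filter.2 ⟨Finset.mem_univ _, a₀, b₀, ha₀, not_lt.1 hb₀, hj₀⟩⟩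
    obtain ⟨a, b, ha, hb, hj⟩ := (Finset.mem_filter.1 hl).2
    have hb' : d b = n + 1 := le_antisymm (hle b) hb
    refine ⟨fun w => if d w < n + 1 then d w else if w = b then n + 1 else n + 2, ?_, ?_, ?_, ?_,
      ?_⟩
    · simp [hr]
    · intro w; grind
    · intro k hk
      rcases Nat.lt_or_ge k (n + 1) with h | h
      · obtain ⟨w, hw⟩ := hsurj k h
        exact ⟨w, by simp [hw, h]⟩
      · exact ⟨b, by simp [hb']; omega⟩
    · intro v w hvw hlt; grind
    · intro w hwr hw
      by_cases h : d w < n + 1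
      · obtain ⟨l', w', h1, h2, h3⟩ := htree w hwr h
        refine ⟨l', w', ?_, h2, fun l'' a b hj ha hb => h3 l'' a b hj ?_ ?_⟩ <;>
          clear htree h3 hmax hsurj hinj ih <;> grind
      · have hwb : w = b := by grind
        subst hwb
        refine ⟨l, a, ?_, hj.symm, fun l'' a b hj ha hb => hmax l'' ?_⟩
        · grind
        · simp only [Finset.mem_filter, Finset.mem_univ, true_and]
          exact ⟨a, b, by grind, by grind, hj⟩

theorem nonempty_scaleTree [Fintype V] [Fintype L] (hG : G.Connected) (μ : L → ℕ) (r : V) :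
    Nonempty (G.ScaleTree μ r) := by
  classical
  have hpos : 0 < Fintype.card V := Fintype.card_pos_iff.2 ⟨r⟩
  obtain ⟨d, hr, hle, hsurj, hinj, htree⟩ :=
    G.exists_partial_scaleTree hG μ r (Fintype.card V - 1) (by omega)
  rw [show Fintype.card V - 1 + 1 = Fintype.card V by omega] at *
  have hlt : ∀ v, d v < Fintype.card V := by
    intro v
    refine lt_of_le_of_ne (hle v) fun h => ?_
    have hsub : Finset.range (Fintype.card V + 1) ⊆ Finset.univ.image d := by
      intro k hk
      rcases Nat.lt_or_ge k (Fintype.card V) with h' | h'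
      · obtain ⟨w, hw⟩ := hsurj k h'
        exact Finset.mem_image.2 ⟨w, Finset.mem_univ _, hw⟩
      · exact Finset.mem_image.2 ⟨v, Finset.mem_univ _, by simp at hk; omega⟩
    have := (Finset.card_le_card hsub).trans Finset.card_image_le
    simp at this
  choose l hl using fun v : {v // v ≠ r} => htree v v.2 (hlt v)
  exact ⟨⟨d, fun v w h => hinj v w h (hlt v), l, fun v => ⟨_, (hl v).choose_spec.1,
    (hl v).choose_spec.2.1⟩, fun v => (hl v).choose_spec.2.2⟩⟩

namespace ScaleTree

variable {G} {μ : L → ℕ} {r : V} (T : G.ScaleTree μ r)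

theorem line_injective : Function.Injective T.line := by
  intro v w h
  obtain ⟨v', hv, hjv⟩ := T.exists_parent v
  obtain ⟨w', hw, hjw⟩ := T.exists_parent w
  rw [h] at hjv
  apply Subtype.ext
  unfold Joins at hjv hjw
  grind

/-- The tree has enough lines in `G^i` to span each of its components: the vertices that are
attached by a line of scale below `i`, and the root, are in distinct components. -/
theorem card_le [Fintype V] [Fintype L] (i : ℕ) :
    Fintype.card V ≤ Nat.card (G.lineGraph (highLines μ i)).ConnectedComponent +
      Nat.card {v : {v // v ≠ r} // i ≤ μ (T.line v)} := by
  classical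
  -- the vertices that start a new component of `G^i` when they are attached
  let B : Set V := {v | ∀ h : v ≠ r, μ (T.line ⟨v, h⟩) < i}
  have hlt : ∀ v ∈ B, ∀ w ∈ B, T.rank v < T.rank w →
      ¬ (G.lineGraph (highLines μ i)).Reachable v w := by
    intro v _ w hw hvw hreach
    obtain ⟨l, hl, a, ha, b, hb, hj⟩ := G.exists_joins_of_reachable hreach
      {x | T.rank x < T.rank w} hvw (by simp)
    by_cases hwr : w = r
    · -- the root has the least rank, since every other vertex has a parent
      have hmin : ∀ n : ℕ, ∀ x, T.rank x = n → T.rank r ≤ n := by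
        intro n
        induction n using Nat.strong_induction_on with
        | _ n ih =>
          intro x hx
          by_cases hxr : x = r
          · exact (hxr ▸ hx).le
          · obtain ⟨y, hy, -⟩ := T.exists_parent ⟨x, hxr⟩
            have := ih (T.rank y) (by simpa [hx] using hy) y rfl
            simp only at hy
            omega
      have := hmin _ v rfl
      subst hwr
      omega
    · have h1 := T.le_of_crossing ⟨w, hwr⟩ l a b hj ha (by simpa using hb)
      have h2 := hw hwr
      have h3 : i ≤ μ l := hl
      omega
  have h1 : Nat.card B ≤ Nat.card (G.lineGraph (highLines μ i)).ConnectedComponent := by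
    refine Nat.card_le_card_of_injective
      (fun v : B => (G.lineGraph (highLines μ i)).connectedComponentMk v) fun v w hvw => ?_
    have hreach := SimpleGraph.ConnectedComponent.exact hvw
    apply Subtype.ext
    rcases lt_trichotomy (T.rank v) (T.rank w) with h | h | h
    · exact (hlt v v.2 w w.2 h hreach).elim
    · exact T.rank_injective h
    · exact (hlt w w.2 v v.2 h hreach.symm).elim
  have h2 : Nat.card (Bᶜ : Set V) ≤ Nat.card {v : {v // v ≠ r} // i ≤ μ (T.line v)} := by
    have hB : ∀ v : (Bᶜ : Set V), ∃ h : v.1 ≠ r, i ≤ μ (T.line ⟨v, h⟩) := by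
      rintro ⟨v, hv⟩
      simpa [B] using hv
    choose hB1 hB2 using hB
    refine Nat.card_le_card_of_injective (fun v => ⟨⟨v.1, hB1 v⟩, hB2 v⟩) fun v w hvw => ?_
    simpa [Subtype.ext_iff] using hvw
  have h3 := Set.ncard_add_ncard_compl B
  rw [← Nat.card_coe_set_eq, ← Nat.card_coe_set_eq, Nat.card_eq_fintype_card (α := V)] at h3
  omega

end ScaleTree

/-! ### The convergence degree of a component -/

theorem card_valence_add (k : VertexKind) [Decidable (k = VertexKind.phi4)] :
    k.valence + 2 * (if k = VertexKind.phi4 then 1 else 0) = 6 := by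
  cases k <;> simp [VertexKind.valence, VertexKind.lastIndex]

theorem barEnd_ne_phiEnd (l l' : L) : G.barEnd l ≠ G.phiEnd l' := fun h => by
  have h1 := G.barEnd_even l
  rw [h] at h1
  exact (Nat.not_even_iff_odd.2 (G.phiEnd_odd l')) h1

/-- Counting half-lines expresses the convergence degree by the numbers of lines and vertices. -/
theorem neg_omega_eq [Fintype V] [Fintype L] (W : Set V) (S : Set L)
    (hbar : ∀ l ∈ S, (G.barEnd l).1 ∈ W) (hphi : ∀ l ∈ S, (G.phiEnd l).1 ∈ W) :
    -G.omega W S = S.ncard + 3 - 3 * W.ncard := by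
  classical
  have h1 : {f : G.Field | f.1 ∈ W}.ncard = G.externalCount W S + 2 * S.ncard := by
    have heq : {f : G.Field | f.1 ∈ W} =
        {f : G.Field | f.1 ∈ W ∧ ∀ l ∈ S, G.barEnd l ≠ f ∧ G.phiEnd l ≠ f} ∪
          (G.barEnd '' S ∪ G.phiEnd '' S) := by
      ext f
      simp only [Set.mem_union, Set.mem_ofPred_eq, Set.mem_image]
      grind
    rw [heq, Set.ncard_union_eq _ (Set.toFinite _) (Set.toFinite _),
      Set.ncard_union_eq _ (Set.toFinite _) (Set.toFinite _),
      Set.ncard_image_of_injective _ G.barEnd_injective,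
      Set.ncard_image_of_injective _ G.phiEnd_injective, externalCount]
    · ring
    · rw [Set.disjoint_left]
      rintro _ ⟨l, -, rfl⟩ ⟨l', -, h⟩
      exact G.barEnd_ne_phiEnd l l' h.symm
    · rw [Set.disjoint_left]
      rintro f ⟨-, hf⟩ (⟨l, hl, h⟩ | ⟨l, hl, h⟩)
      · exact (hf l hl).1 h
      · exact (hf l hl).2 h
  have h2 : {f : G.Field | f.1 ∈ W}.ncard + 2 * G.fourCount W = 6 * W.ncard := by
    have e1 : {f : G.Field | f.1 ∈ W} =
        (((Finset.univ.filter (· ∈ W)).sigma fun v =>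
          (Finset.univ : Finset (Fin (G.kind v).valence))
          : Finset G.Field) : Set G.Field) := by
      ext f; simp
    have e2 : {v ∈ W | G.kind v = VertexKind.phi4} =
        (((Finset.univ.filter (· ∈ W)).filter fun v => G.kind v = VertexKind.phi4
          : Finset V) : Set V) := by
      ext f; simp
    have e3 : W = ((Finset.univ.filter (· ∈ W) : Finset V) : Set V) := by ext; simp
    rw [fourCount, e1, e2, Set.ncard_coe_finset, Set.ncard_coe_finset, Finset.card_sigma,
      Finset.card_filter, Finset.mul_sum, ← Finset.sum_add_distrib]
    conv_rhs => rw [e3, Set.ncard_coe_finset]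
    simp only [Finset.card_univ, Fintype.card_fin]
    rw [Finset.sum_congr rfl fun v _ => card_valence_add (G.kind v)]
    simp [mul_comm]
  have h3 : ((G.externalCount W S + 2 * S.ncard + 2 * G.fourCount W : ℕ) : ℝ) =
      ((6 * W.ncard : ℕ) : ℝ) := by rw [← h1, h2]
  push_cast at h3
  rw [omega]
  linarith

/-- The sum of the convergence degrees of the components of `G^i`: isolated vertices, which are
not components, would contribute nothing. -/
theorem sum_neg_omega_eq [Fintype V] [Fintype L] (μ : L → ℕ) (i : ℕ)
    [Fintype (G.Component μ i)] :
    ∑ c : G.Component μ i, -G.omega c.1.supp c.lines =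
      ((highLines μ i).ncard : ℝ) +
        3 * Nat.card (G.lineGraph (highLines μ i)).ConnectedComponent - 3 * Fintype.card V := by
  classical
  set H := G.lineGraph (highLines μ i) with hH
  let ls : H.ConnectedComponent → Set L := fun c =>
    {l | l ∈ highLines μ i ∧ (G.barEnd l).1 ∈ c.supp}
  have hphi : ∀ (c : H.ConnectedComponent), ∀ l ∈ highLines μ i,
      ((G.phiEnd l).1 ∈ c.supp ↔ (G.barEnd l).1 ∈ c.supp) := by
    intro c l hl
    by_cases h : (G.barEnd l).1 = (G.phiEnd l).1
    · rw [h]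
    · have hadj : H.Adj (G.barEnd l).1 (G.phiEnd l).1 :=
        G.lineGraph_adj_iff.2 ⟨h, l, hl, Or.inl ⟨rfl, rfl⟩⟩
      simp only [SimpleGraph.ConnectedComponent.mem_supp_iff]
      rw [SimpleGraph.ConnectedComponent.sound hadj.reachable]
  let f : H.ConnectedComponent → ℝ := fun c => (ls c).ncard + 3 - 3 * c.supp.ncard
  have h1 : ∀ c : G.Component μ i, -G.omega c.1.supp c.lines = f c.1 := fun c =>
    G.neg_omega_eq _ _ (fun l hl => hl.2) (fun l hl => (hphi c.1 l hl.1).2 hl.2)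
  have h2 : ∀ c : H.ConnectedComponent,
      f c ≠ 0 → ∃ l ∈ highLines μ i, (G.barEnd l).1 ∈ c.supp := by
    intro c hfc
    by_contra! hne
    apply hfc
    have e1 : ls c = ∅ := by
      ext l; simp only [ls, Set.mem_ofPred_eq, Set.mem_empty_iff_false, iff_false, not_and]
      exact hne l
    have e2 : c.supp.ncard = 1 := by
      obtain ⟨v, hv⟩ := c.nonempty_supp
      rw [Set.ncard_eq_one]
      refine ⟨v, Set.eq_singleton_iff_unique_mem.2 ⟨hv, fun w hw => ?_⟩⟩
      by_contra hwv
      have hreach : H.Reachable v w :=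
        SimpleGraph.ConnectedComponent.exact ((hv : _ = c).trans (hw : _ = c).symm)
      obtain ⟨l, hl, a, rfl, b, -, hj⟩ :=
        G.exists_joins_of_reachable hreach {v} rfl (by simpa using hwv)
      rcases hj with ⟨h, -⟩ | ⟨-, h⟩
      · exact hne l hl (h ▸ hv)
      · exact hne l hl ((hphi c l hl).1 (h ▸ hv))
    simp only [f, e1, e2]
    norm_num
  have h3 : ∑ c : G.Component μ i, -G.omega c.1.supp c.lines = ∑ c, f c := by
    rw [Finset.sum_congr rfl fun c _ => h1 c, ← Finset.sum_filter_of_ne fun c _ => h2 c]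
    exact (Finset.sum_subtype _ (by simp; exact fun _ => Iff.rfl) f).symm
  have h4 : ∑ c : H.ConnectedComponent, (ls c).ncard = (highLines μ i).ncard := by
    rw [Set.ncard_eq_toFinset_card' (highLines μ i),
      Finset.card_eq_sum_card_fiberwise (t := Finset.univ)
        (f := fun l => H.connectedComponentMk (G.barEnd l).1) (by simp [Set.MapsTo])]
    refine Finset.sum_congr rfl fun c _ => ?_
    rw [← Set.ncard_coe_finset]
    congr 1
    ext l
    simp [ls]
  have h5 : ∑ c : H.ConnectedComponent, c.supp.ncard = Fintype.card V := by
    rw [← Finset.card_univ, Finset.card_eq_sum_card_fiberwise (t := Finset.univ)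
        (f := fun v => H.connectedComponentMk v) (by simp [Set.MapsTo])]
    refine Finset.sum_congr rfl fun c _ => ?_
    rw [← Set.ncard_coe_finset]
    congr 1
    ext l
    simp
  rw [h3, Finset.sum_sub_distrib, Finset.sum_add_distrib, ← Finset.mul_sum, ← h5, ← h4]
  push_cast
  simp [Nat.card_eq_fintype_card, mul_comm]
  rfl

/-- The power counting of a tree adapted to the scales: a factor `M ^ i` for every line of scale
`i`, and `M ^ (-3 * i)` for every line of the tree. -/
theorem ScaleTree.prod_le_powerCounting [Fintype V] [Fintype L] {G : FeynmanGraph V L}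
    {μ : L → ℕ} {r : V} [Fintype {v // v ≠ r}]
    (T : G.ScaleTree μ r) {M : ℝ} (hM : 1 < M) :
    (∏ l, M ^ μ l) * ∏ v, (M ^ (3 * μ (T.line v)))⁻¹ ≤ G.powerCounting M μ := by
  classical
  have hM0 : 0 < M := by linarith
  set n := Finset.univ.sup μ with hn
  have hle : ∀ l, μ l ≤ n := fun l => Finset.le_sup (f := μ) (Finset.mem_univ l)
  have hcount : ∀ k ≤ n, (k : ℝ) = ∑ i ∈ Finset.Icc 1 n, if i ≤ k then (1 : ℝ) else 0 := by
    intro k hk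
    rw [← Finset.sum_filter, show (Finset.Icc 1 n).filter (· ≤ k) = Finset.Icc 1 k by
      ext i; simp; omega]
    simp
  have hL : ∑ l, (μ l : ℝ) = ∑ i ∈ Finset.Icc 1 n, ((highLines μ i).ncard : ℝ) := by
    rw [Finset.sum_congr rfl fun l _ => hcount _ (hle l), Finset.sum_comm]
    refine Finset.sum_congr rfl fun i _ => ?_
    rw [Finset.sum_boole, ← Set.ncard_coe_finset]
    congr 2
    ext l
    simp [highLines]
  have hT : ∑ v, (μ (T.line v) : ℝ) = ∑ i ∈ Finset.Icc 1 n,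
      (Nat.card {v : {v // v ≠ r} // i ≤ μ (T.line v)} : ℝ) := by
    rw [Finset.sum_congr rfl fun v _ => hcount _ (hle (T.line v)), Finset.sum_comm]
    refine Finset.sum_congr rfl fun i _ => ?_
    rw [Finset.sum_boole, Nat.card_eq_fintype_card, Fintype.card_subtype]
  have e1 : (∏ l, M ^ μ l) * ∏ v, (M ^ (3 * μ (T.line v)))⁻¹ =
      M ^ (∑ l, (μ l : ℝ) - 3 * ∑ v, (μ (T.line v) : ℝ)) := by
    rw [Finset.prod_inv_distrib, Finset.prod_pow_eq_pow_sum, Finset.prod_pow_eq_pow_sum,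
      Real.rpow_sub hM0, div_eq_mul_inv]
    congr 1
    · rw [← Real.rpow_natCast]; push_cast; rfl
    · rw [← Real.rpow_natCast]; push_cast; rw [Finset.mul_sum]
  have e2 : G.powerCounting M μ = M ^ (∑ i ∈ Finset.Icc 1 n, (((highLines μ i).ncard : ℝ) +
        3 * Nat.card (G.lineGraph (highLines μ i)).ConnectedComponent - 3 * Fintype.card V)) := by
    rw [powerCounting, Real.rpow_sum_of_pos hM0]
    refine Finset.prod_congr rfl fun i _ => ?_
    rw [finprod_eq_prod_of_fintype, ← G.sum_neg_omega_eq μ i, Real.rpow_sum_of_pos hM0]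
  rw [e1, e2, hL, hT, Finset.mul_sum, ← Finset.sum_sub_distrib]
  refine Real.rpow_le_rpow_of_exponent_le hM.le (Finset.sum_le_sum fun i _ => ?_)
  have h : (Fintype.card V : ℝ) ≤ Nat.card (G.lineGraph (highLines μ i)).ConnectedComponent +
      Nat.card {v : {v // v ≠ r} // i ≤ μ (T.line v)} := by exact_mod_cast T.card_le i
  linarith

end FeynmanGraph

/-! ### Coordinates on the configurations of a vertex -/

/-- The positions at a vertex other than that of the field `q`; the slot of `q` is taken by the last
field. -/
noncomputable def vertexChart {k : ℕ} (q : Fin (k + 1)) (y : Fin k → Plane) : Fin k → Plane :=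
  fun j => vertexPositions y (Equiv.swap q (Fin.last k) j.castSucc)

/-- The positions at a vertex, from the positions `vertexChart q` of all its fields but `q`;
the position of `q` is the one at which the alternating sum of all positions vanishes. -/
noncomputable def vertexFill {k : ℕ} (q : Fin (k + 1)) (z : Fin k → Plane) : Fin (k + 1) → Plane :=
  fun j => Fin.snoc (α := fun _ => Plane) z
    (-((-1 : ℝ) ^ (q : ℕ) • ∑ i : Fin k,
      (-1 : ℝ) ^ (Equiv.swap q (Fin.last k) i.castSucc : ℕ) • z i))
    (Equiv.swap q (Fin.last k) j)

theorem vertexFill_apply_swap_castSucc {k : ℕ} (q : Fin (k + 1)) (z : Fin k → Plane) (j : Fin k) :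
    vertexFill q z (Equiv.swap q (Fin.last k) j.castSucc) = z j := by
  simp [vertexFill]

theorem vertexFill_vertexChart {k : ℕ} (hk : Odd k) (q : Fin (k + 1)) (y : Fin k → Plane) :
    vertexFill q (vertexChart q y) = vertexPositions y := by
  funext j
  obtain ⟨i, rfl⟩ := (Equiv.swap q (Fin.last k)).surjective j
  induction i using Fin.lastCases with
  | cast i => rw [vertexFill_apply_swap_castSucc, vertexChart]
  | last =>
    have h := sum_vertexPositions hk y
    rw [← Equiv.sum_comp (Equiv.swap q (Fin.last k)), Fin.sum_univ_castSucc,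
      Equiv.swap_apply_right] at h
    simp only [vertexFill, vertexChart, Equiv.swap_apply_right, Equiv.swap_apply_left,
      Fin.snoc_last]
    rw [eq_neg_of_add_eq_zero_left h, smul_neg, neg_neg, smul_smul, ← pow_add,
      (Even.add_self _).neg_one_pow, one_smul]

theorem continuous_vertexPositions {k : ℕ} :
    Continuous (vertexPositions : (Fin k → Plane) → Fin (k + 1) → Plane) := by
  refine continuous_pi fun j => ?_
  unfold vertexPositions
  induction j using Fin.lastCases with
  | cast i => simpa using continuous_apply i
  | last => simp only [Fin.snoc_last]; fun_prop

theorem continuous_vertexFill {k : ℕ} (q : Fin (k + 1)) :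
    Continuous (vertexFill q : (Fin k → Plane) → Fin (k + 1) → Plane) := by
  refine continuous_pi fun j => ?_
  unfold vertexFill
  obtain ⟨i, rfl⟩ := (Equiv.swap q (Fin.last k)).surjective j
  induction i using Fin.lastCases with
  | cast i => simpa using continuous_apply i
  | last =>
    simp only [Equiv.swap_apply_right, Equiv.swap_apply_left, Fin.snoc_last]; fun_prop

/-- It does not matter which of the fields of a vertex is eliminated by the `δ` function. -/
theorem measurePreserving_vertexChart {k : ℕ} (q : Fin (k + 1)) :
    MeasurePreserving (vertexChart q) := by
  induction q using Fin.lastCases with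
  | last =>
    have : vertexChart (Fin.last k) = id := by
      funext y j
      simp [vertexChart, vertexPositions]
    rw [this]
    exact MeasurePreserving.id _
  | cast q =>
    let c : (Fin k → Plane) → Plane := fun y =>
      ∑ j ∈ Finset.univ.erase q, (-1 : ℝ) ^ (j : ℕ) • y j
    have hchart : vertexChart q.castSucc =
        fun y => Function.update y q ((-1 : ℝ) ^ (q : ℕ) • y q + c y) := by
      funext y j
      by_cases h : j = q
      · subst h
        simp only [vertexChart, vertexPositions, Equiv.swap_apply_left, Fin.snoc_last,
          Function.update_self, c]
        rw [Finset.add_sum_erase _ (fun j : Fin k => (-1 : ℝ) ^ (j : ℕ) • y j)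
          (Finset.mem_univ j)]
      · rw [Function.update_of_ne h, vertexChart, Equiv.swap_apply_of_ne_of_ne
          (by simpa using h) (Fin.castSucc_lt_last j).ne]
        simp [vertexPositions]
    rw [hchart]
    refine measurePreserving_update_shear q _ (neg_one_pow_eq_or ℝ _) c
      (by fun_prop) fun x t => Finset.sum_congr rfl fun j hj => ?_
    rw [Function.update_of_ne (Finset.ne_of_mem_erase hj)]

namespace FeynmanGraph

variable {V L : Type} (G : FeynmanGraph V L)

theorem odd_lastIndex (k : VertexKind) : Odd k.lastIndex := by
  cases k <;> simp [VertexKind.lastIndex] <;> decide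

/-- The field whose position is the coordinate `p`, if at each vertex `v` the position of
the field `q v` is eliminated. -/
def slotField (q : ∀ v, Fin (G.kind v).valence) (p : (v : V) × Fin (G.kind v).lastIndex) :
    G.Field :=
  ⟨p.1, Equiv.swap (q p.1) (Fin.last _) p.2.castSucc⟩

variable {G} in
theorem slotField_ne (q : ∀ v, Fin (G.kind v).valence) (p : (v : V) × Fin (G.kind v).lastIndex) :
    (G.slotField q p).2 ≠ q (G.slotField q p).1 := by
  simp only [slotField]
  rw [Ne, Equiv.swap_apply_eq_iff, Equiv.swap_apply_left]
  exact (Fin.castSucc_lt_last _).ne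

variable {G} in
theorem exists_slotField_eq (q : ∀ v, Fin (G.kind v).valence) {f : G.Field} (hf : f.2 ≠ q f.1) :
    ∃ p, G.slotField q p = f := by
  obtain ⟨v, j⟩ := f
  obtain ⟨i, rfl⟩ := (Equiv.swap (q v) (Fin.last _)).surjective j
  induction i using Fin.lastCases with
  | cast i => exact ⟨⟨v, i⟩, rfl⟩
  | last => exact (hf (by simp)).elim

/-- The positions of all fields, from the coordinates that belong to the choice `q`. -/
noncomputable def fillPos (q : ∀ v, Fin (G.kind v).valence)
    (z : (v : V) × Fin (G.kind v).lastIndex → Plane) (f : G.Field) : Plane :=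
  vertexFill (q f.1) (fun j => z ⟨f.1, j⟩) f.2

variable {G} in
theorem fillPos_slotField (q : ∀ v, Fin (G.kind v).valence)
    (z : (v : V) × Fin (G.kind v).lastIndex → Plane) (p : (v : V) × Fin (G.kind v).lastIndex) :
    G.fillPos q z (G.slotField q p) = z p :=
  vertexFill_apply_swap_castSucc _ _ _

theorem measurable_fillPos (q : ∀ v, Fin (G.kind v).valence) (f : G.Field) :
    Measurable fun z => G.fillPos q z f := by
  unfold fillPos
  exact (measurable_pi_apply f.2).comp
    ((continuous_vertexFill (q f.1)).measurable.comp (by fun_prop))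

theorem prod_slotField [Fintype V] {α : Type*} [CommMonoid α]
    (q : ∀ v, Fin (G.kind v).valence) (g : G.Field → α) (hg : ∀ v, g ⟨v, q v⟩ = 1) :
    ∏ f, g f = ∏ p, g (G.slotField q p) := by
  rw [Fintype.prod_sigma, Fintype.prod_sigma]
  refine Finset.prod_congr rfl fun v _ => ?_
  rw [← Equiv.prod_comp (Equiv.swap (q v) (Fin.last _)), Fin.prod_univ_castSucc,
    Equiv.swap_apply_right, hg, mul_one]
  rfl

/-- The integral over the positions in the plane, when every field but the eliminated ones `q v`
has one decaying factor, in its position relative to that of its partner, if it has one.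
The ranks make the change of variables triangular. -/
theorem lintegral_prod_decay_eq [Fintype V] (q : ∀ v, Fin (G.kind v).valence)
    [∀ f : G.Field, Decidable (f.2 = q f.1)]
    (sc : G.Field → ℝ) (hsc : ∀ f, 0 < sc f) (partner : G.Field → Option G.Field)
    (rk : G.Field → ℕ)
    (h1 : ∀ f f', f.2 ≠ q f.1 → partner f = some f' → f'.2 ≠ q f'.1 → rk f < rk f')
    (h2 : ∀ f f', f.2 ≠ q f.1 → partner f = some f' → f'.2 = q f'.1 →
      ∀ g : G.Field, g.1 = f'.1 → g.2 ≠ q g.1 → rk f < rk g) :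
    ∫⁻ y : (v : V) → Fin (G.kind v).lastIndex → Plane,
      ENNReal.ofReal (∏ f : G.Field, if f.2 = q f.1 then 1 else
        decay (sc f • (vertexPositions (y f.1) f.2 -
          (partner f).elim 0 fun f' => vertexPositions (y f'.1) f'.2))) =
    ENNReal.ofReal (∏ f : G.Field, if f.2 = q f.1 then 1 else
      (sc f ^ 2)⁻¹ * ∫ x : Plane, decay x) := by
  classical
  have hfin : Module.finrank ℝ Plane = 2 := by simp
  have hmp : MeasurePreserving (fun (y : (v : V) → Fin (G.kind v).lastIndex → Plane)
      (p : (v : V) × Fin (G.kind v).lastIndex) => vertexChart (q p.1) (y p.1) p.2) :=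
    (measurePreserving_sigmaUncurry (E := Plane)).comp
      (volume_preserving_pi fun v => measurePreserving_vertexChart (q v))
  have hfill : ∀ (y : (v : V) → Fin (G.kind v).lastIndex → Plane) (f : G.Field),
      vertexPositions (y f.1) f.2 = G.fillPos q
        (fun p : (v : V) × Fin (G.kind v).lastIndex => vertexChart (q p.1) (y p.1) p.2) f := by
    intro y f
    exact (congrFun (vertexFill_vertexChart (odd_lastIndex _) (q f.1) (y f.1)) f.2).symm
  let c : (v : V) × Fin (G.kind v).lastIndex →
      ((v : V) × Fin (G.kind v).lastIndex → Plane) → Plane := fun p z =>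
    (partner (G.slotField q p)).elim 0 (G.fillPos q z)
  have hc : ∀ p, Measurable (c p) := by
    intro p
    simp only [c]
    cases partner (G.slotField q p) with
    | none => exact measurable_const
    | some f' => exact G.measurable_fillPos q f'
  let g : (v : V) × Fin (G.kind v).lastIndex → Plane → ℝ≥0∞ := fun p x =>
    ENNReal.ofReal (decay (sc (G.slotField q p) • x))
  have hg : ∀ p, Measurable (g p) := fun p =>
    ENNReal.measurable_ofReal.comp (continuous_decay.measurable.comp (measurable_const_smul _))
  have hdep : ∀ p z z', (∀ p', rk (G.slotField q p) < rk (G.slotField q p') → z p' = z' p') →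
      c p z = c p z' := by
    intro p z z' hz
    simp only [c]
    cases hpart : partner (G.slotField q p) with
    | none => rfl
    | some f' =>
      simp only [Option.elim_some]
      by_cases hf' : f'.2 = q f'.1
      · have hzz : (fun j => z ⟨f'.1, j⟩) = fun j => z' ⟨f'.1, j⟩ := funext fun j =>
          hz ⟨f'.1, j⟩ (h2 _ f' (slotField_ne q p) hpart hf' _ rfl (slotField_ne q _))
        simp only [fillPos, hzz]
      · obtain ⟨p', rfl⟩ := exists_slotField_eq q hf'
        rw [fillPos_slotField, fillPos_slotField]
        exact hz p' (h1 _ _ (slotField_ne q p) hpart hf')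
  have htri := lintegral_prod_sub_of_triangular (fun p => rk (G.slotField q p)) g hg c hc hdep
  have hint : ∀ z, ENNReal.ofReal (∏ f : G.Field, if f.2 = q f.1 then 1 else
        decay (sc f • (G.fillPos q z f - (partner f).elim 0 (G.fillPos q z)))) =
      ∏ p, g p (z p - c p z) := by
    intro z
    rw [G.prod_slotField q _ fun v => by simp, ENNReal.ofReal_prod_of_nonneg]
    · refine Finset.prod_congr rfl fun p _ => ?_
      rw [if_neg (slotField_ne q p), fillPos_slotField]
    · intro p _
      split_ifs
      exacts [zero_le_one, (decay_pos _).le]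
  calc _ = ∫⁻ y : (v : V) → Fin (G.kind v).lastIndex → Plane, ∏ p, g p
        (vertexChart (q p.1) (y p.1) p.2 -
          c p (fun p : (v : V) × Fin (G.kind v).lastIndex =>
            vertexChart (q p.1) (y p.1) p.2)) := by
        refine lintegral_congr fun y => ?_
        simp only [hfill y]
        exact hint _
    _ = ∫⁻ z, ∏ p, g p (z p - c p z) := by
        refine hmp.lintegral_comp (f := fun z => ∏ p, g p (z p - c p z)) ?_
        exact Finset.measurable_fun_prod _ fun p _ =>
          (hg p).comp ((measurable_pi_apply p).sub (hc p))
    _ = ∏ p, ENNReal.ofReal ((sc (G.slotField q p) ^ 2)⁻¹ * ∫ x : Plane, decay x) := by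
        rw [htri]
        refine Finset.prod_congr rfl fun p _ => ?_
        rw [lintegral_decay_smul hfin.le (hsc _), hfin]
    _ = _ := by
        have hnn : 0 ≤ ∫ x : Plane, decay x := integral_nonneg fun x => (decay_pos x).le
        rw [G.prod_slotField q _ fun v => by simp, ENNReal.ofReal_prod_of_nonneg]
        · exact Finset.prod_congr rfl fun p _ => by rw [if_neg (slotField_ne q p)]
        · intro p _
          split_ifs
          · exact zero_le_one
          · have := hsc (G.slotField q p)
            positivity

/-! ### The integral over the commuting coordinates -/

/-- The integral over the commuting coordinates: those of all vertices but the root relative to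
their parents, and that of the root against the decay of its external field. -/
theorem ScaleTree.lintegral_prod_decay_eq [Fintype V] [DecidableEq V] {G : FeynmanGraph V L}
    {μ : L → ℕ} {r : V} (T : G.ScaleTree μ r) (s : L → ℝ) (hs : ∀ l, 0 < s l) :
    ∫⁻ t : V → ℝ, ENNReal.ofReal (decay (t r) * ∏ v, decay
      (s (T.line v) • (t (G.barEnd (T.line v)).1 - t (G.phiEnd (T.line v)).1))) =
    ENNReal.ofReal ((∫ x : ℝ, decay x) * ∏ v, (s (T.line v))⁻¹ * ∫ x : ℝ, decay x) := by
  have hfin : Module.finrank ℝ ℝ = 1 := by simp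
  choose par hpar hjoin using T.exists_parent
  let sc : V → ℝ := fun v => if h : v ≠ r then s (T.line ⟨v, h⟩) else 1
  have hsc : ∀ v, 0 < sc v := fun v => by
    simp only [sc]
    split_ifs
    exacts [hs _, one_pos]
  let c : V → (V → ℝ) → ℝ := fun v t => if h : v ≠ r then t (par ⟨v, h⟩) else 0
  have hc : ∀ v, Measurable (c v) := by
    intro v
    by_cases h : v ≠ r
    · simp only [c, dif_pos h]; fun_prop
    · simp only [c, dif_neg h]; fun_prop
  have hdep : ∀ v x y, (∀ w, OrderDual.toDual (T.rank v) < OrderDual.toDual (T.rank w) →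
      x w = y w) → c v x = c v y := by
    intro v x y hxy
    by_cases h : v ≠ r
    · simp only [c, dif_pos h]
      exact hxy _ (OrderDual.toDual_lt_toDual.2 (hpar ⟨v, h⟩))
    · simp only [c, dif_neg h]
  have htri := lintegral_prod_sub_of_triangular (E := ℝ)
    (fun v => OrderDual.toDual (T.rank v)) (fun v x => ENNReal.ofReal (decay (sc v • x)))
    (fun v => ENNReal.measurable_ofReal.comp
      (continuous_decay.measurable.comp (measurable_const_smul _))) c hc hdep
  have hr : sc r = 1 := by simp [sc]
  have hv : ∀ v : {v // v ≠ r}, sc v = s (T.line v) := fun v => by simp [sc, v.2]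
  have hint : ∀ t : V → ℝ, ENNReal.ofReal (decay (t r) * ∏ v, decay
      (s (T.line v) • (t (G.barEnd (T.line v)).1 - t (G.phiEnd (T.line v)).1))) =
      ∏ v, ENNReal.ofReal (decay (sc v • (t v - c v t))) := by
    intro t
    rw [← ENNReal.ofReal_prod_of_nonneg (fun v _ => (decay_pos _).le),
      Fintype.prod_eq_mul_prod_subtype_ne (M := ℝ) _ r]
    congr 2
    · simp [hr, c]
    · refine Fintype.prod_congr _ _ fun v => ?_
      rw [hv]
      simp only [c, dif_pos v.2, Subtype.coe_eta]
      rcases hjoin v with ⟨h1, h2⟩ | ⟨h1, h2⟩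
      · rw [h1, h2]
      · rw [h1, h2, ← decay_neg, ← smul_neg, neg_sub]
  have hnn : 0 ≤ ∫ x : ℝ, decay x := integral_nonneg fun x => (decay_pos x).le
  rw [lintegral_congr hint, htri]
  simp only [lintegral_decay_smul (hfin.le.trans one_le_two) (hsc _), hfin, pow_one]
  rw [← ENNReal.ofReal_prod_of_nonneg, Fintype.prod_eq_mul_prod_subtype_ne _ r]
  · congr 2
    · rw [hr, inv_one, one_mul]
    · exact Fintype.prod_congr _ _ fun v => by rw [hv]
  · intro v _
    have := hsc v
    positivity

/-! ### The choice of a decaying factor for every field -/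

/-- Every field is external, or one of the ends of exactly one line. -/
noncomputable def fieldEquiv : G.ExternalField ⊕ L ⊕ L ≃ G.Field :=
  Equiv.ofBijective (Sum.elim Subtype.val (Sum.elim G.barEnd G.phiEnd)) <| by
    constructor
    · rintro (e | l | l) (e' | l' | l') h <;> simp only [Sum.elim_inl, Sum.elim_inr] at h
      · rw [Subtype.ext h]
      · exact ((e.2 l').1 h.symm).elim
      · exact ((e.2 l').2 h.symm).elim
      · exact ((e'.2 l).1 h).elim
      · rw [G.barEnd_injective h]
      · exact (G.barEnd_ne_phiEnd _ _ h).elim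
      · exact ((e'.2 l).2 h).elim
      · exact (G.barEnd_ne_phiEnd _ _ h.symm).elim
      · rw [G.phiEnd_injective h]
    · intro f
      by_cases h : ∀ l, G.barEnd l ≠ f ∧ G.phiEnd l ≠ f
      · exact ⟨Sum.inl ⟨f, h⟩, rfl⟩
      · push Not at h
        obtain ⟨l, hl⟩ := h
        by_cases hb : G.barEnd l = f
        · exact ⟨Sum.inr (Sum.inl l), hb⟩
        · exact ⟨Sum.inr (Sum.inr l), hl hb⟩

/-- The function on the fields with the given values at the external fields, at the `φ̄` ends and
at the `φ` ends of the lines. -/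
noncomputable def fieldCases {α : Type*} (a : G.ExternalField → α) (b c : L → α)
    (f : G.Field) : α :=
  Sum.elim a (Sum.elim b c) (G.fieldEquiv.symm f)

section fieldCases

variable {α : Type*} (a : G.ExternalField → α) (b c : L → α)

@[simp] theorem fieldCases_external (e : G.ExternalField) : G.fieldCases a b c e.1 = a e := by
  rw [fieldCases, show e.1 = G.fieldEquiv (Sum.inl e) from rfl, Equiv.symm_apply_apply,
    Sum.elim_inl]

@[simp] theorem fieldCases_barEnd (l : L) : G.fieldCases a b c (G.barEnd l) = b l := by
  rw [fieldCases, show G.barEnd l = G.fieldEquiv (Sum.inr (Sum.inl l)) from rfl,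
    Equiv.symm_apply_apply, Sum.elim_inr, Sum.elim_inl]

@[simp] theorem fieldCases_phiEnd (l : L) : G.fieldCases a b c (G.phiEnd l) = c l := by
  rw [fieldCases, show G.phiEnd l = G.fieldEquiv (Sum.inr (Sum.inr l)) from rfl,
    Equiv.symm_apply_apply, Sum.elim_inr, Sum.elim_inr]

theorem field_induction {P : G.Field → Prop} (h1 : ∀ e : G.ExternalField, P e.1)
    (h2 : ∀ l, P (G.barEnd l)) (h3 : ∀ l, P (G.phiEnd l)) (f : G.Field) : P f := by
  obtain ⟨e | l | l, rfl⟩ := G.fieldEquiv.surjective f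
  exacts [h1 e, h2 l, h3 l]

theorem prod_field [Fintype V] [Fintype L] [Fintype G.ExternalField] {α : Type*} [CommMonoid α]
    (g : G.Field → α) :
    ∏ f, g f = (∏ e : G.ExternalField, g e.1) * ∏ l, g (G.barEnd l) * g (G.phiEnd l) := by
  rw [← Equiv.prod_comp G.fieldEquiv, Fintype.prod_sum_type, Fintype.prod_sum_type,
    Finset.prod_mul_distrib]
  rfl

end fieldCases

theorem card_field_le [Fintype V] : Fintype.card G.Field ≤ 6 * Fintype.card V := by
  rw [Fintype.card_sigma]
  simp only [Fintype.card_fin]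
  refine (Finset.sum_le_card_nsmul _ _ 6 fun v _ => ?_).trans (by simp [mul_comm])
  cases G.kind v <;> simp [VertexKind.lastIndex]

/-- The fields whose positions are eliminated by the `δ` functions: at the root it is a
given external field, at any other vertex the end of the line to its parent. -/
structure ExitFields {G : FeynmanGraph V L} {μ : L → ℕ} (e₀ : G.ExternalField)
    (T : G.ScaleTree μ e₀.1.1) where
  exit : ∀ v, Fin (G.kind v).valence
  exit_root : (⟨e₀.1.1, exit e₀.1.1⟩ : G.Field) = e₀.1
  exit_line : ∀ v : {v // v ≠ e₀.1.1},
    (G.barEnd (T.line v) = ⟨v, exit v⟩ ∧ T.rank (G.phiEnd (T.line v)).1 < T.rank v) ∨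
    (G.phiEnd (T.line v) = ⟨v, exit v⟩ ∧ T.rank (G.barEnd (T.line v)).1 < T.rank v)

theorem nonempty_exitFields {G : FeynmanGraph V L} {μ : L → ℕ} (e₀ : G.ExternalField)
    (T : G.ScaleTree μ e₀.1.1) : Nonempty (ExitFields e₀ T) := by
  classical
  have h : ∀ v, ∃ j : Fin (G.kind v).valence,
      (v = e₀.1.1 → (⟨v, j⟩ : G.Field) = e₀.1) ∧ ∀ h : v ≠ e₀.1.1,
        (G.barEnd (T.line ⟨v, h⟩) = ⟨v, j⟩ ∧
          T.rank (G.phiEnd (T.line ⟨v, h⟩)).1 < T.rank v) ∨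
        (G.phiEnd (T.line ⟨v, h⟩) = ⟨v, j⟩ ∧
          T.rank (G.barEnd (T.line ⟨v, h⟩)).1 < T.rank v) := by
    intro v
    by_cases hv : v = e₀.1.1
    · subst hv
      exact ⟨e₀.1.2, fun _ => rfl, fun h => (h rfl).elim⟩
    · obtain ⟨w, hw, ⟨h1, h2⟩ | ⟨h1, h2⟩⟩ := T.exists_parent ⟨v, hv⟩
      · simp only at hw h1 h2
        generalize hf : G.barEnd (T.line ⟨v, hv⟩) = f at h1
        obtain ⟨v', j⟩ := f
        simp only at h1
        subst h1
        exact ⟨j, fun h => (hv h).elim, fun _ => Or.inl ⟨hf, by rwa [h2]⟩⟩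
      · simp only at hw h1 h2
        generalize hf : G.phiEnd (T.line ⟨v, hv⟩) = f at h2
        obtain ⟨v', j⟩ := f
        simp only at h2
        subst h2
        exact ⟨j, fun h => (hv h).elim, fun _ => Or.inr ⟨hf, by rwa [h1]⟩⟩
  choose q hq1 hq2 using h
  exact ⟨⟨q, hq1 _ rfl, fun v => hq2 v v.2⟩⟩

namespace ExitFields

variable {G} {μ : L → ℕ} {e₀ : G.ExternalField} {T : G.ScaleTree μ e₀.1.1} (E : ExitFields e₀ T)

/-- The position of the field `f` is eliminated. -/
def IsExit (f : G.Field) : Prop := f.2 = E.exit f.1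

instance (f : G.Field) : Decidable (E.IsExit f) := inferInstanceAs (Decidable (f.2 = E.exit f.1))

theorem isExit_mk (v : V) : E.IsExit ⟨v, E.exit v⟩ := rfl

theorem eq_of_isExit {f : G.Field} (h : E.IsExit f) : f = ⟨f.1, E.exit f.1⟩ := by
  obtain ⟨v, j⟩ := f
  have : j = E.exit v := h
  rw [this]

theorem isExit_external_iff (e : G.ExternalField) : E.IsExit e.1 ↔ e = e₀ := by
  constructor
  · intro h
    have heq := E.eq_of_isExit h
    by_cases hr : e.1.1 = e₀.1.1
    · apply Subtype.ext
      rw [heq, hr, E.exit_root]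
    · rcases E.exit_line ⟨_, hr⟩ with ⟨h1, -⟩ | ⟨h1, -⟩
      · exact ((e.2 _).1 (h1.trans heq.symm)).elim
      · exact ((e.2 _).2 (h1.trans heq.symm)).elim
  · rintro rfl
    have := E.isExit_mk e.1.1
    rwa [E.exit_root] at this

theorem isExit_barEnd {l : L} (h : E.IsExit (G.barEnd l)) :
    l ∈ Set.range T.line ∧ T.rank (G.phiEnd l).1 < T.rank (G.barEnd l).1 := by
  have heq := E.eq_of_isExit h
  by_cases hr : (G.barEnd l).1 = e₀.1.1
  · rw [hr, E.exit_root] at heq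
    exact ((e₀.2 l).1 heq).elim
  · rcases E.exit_line ⟨_, hr⟩ with ⟨h1, h2⟩ | ⟨h1, -⟩
    · have hl := G.barEnd_injective (h1.trans heq.symm)
      rw [hl] at h2
      exact ⟨⟨_, hl⟩, h2⟩
    · exact (G.barEnd_ne_phiEnd _ _ (heq.trans h1.symm)).elim

theorem isExit_phiEnd {l : L} (h : E.IsExit (G.phiEnd l)) :
    l ∈ Set.range T.line ∧ T.rank (G.barEnd l).1 < T.rank (G.phiEnd l).1 := by
  have heq := E.eq_of_isExit h
  by_cases hr : (G.phiEnd l).1 = e₀.1.1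
  · rw [hr, E.exit_root] at heq
    exact ((e₀.2 l).2 heq).elim
  · rcases E.exit_line ⟨_, hr⟩ with ⟨h1, -⟩ | ⟨h1, h2⟩
    · exact (G.barEnd_ne_phiEnd _ _ (h1.trans heq.symm)).elim
    · have hl := G.phiEnd_injective (h1.trans heq.symm)
      rw [hl] at h2
      exact ⟨⟨_, hl⟩, h2⟩

theorem isExit_or_of_mem_range {l : L} (h : l ∈ Set.range T.line) :
    E.IsExit (G.barEnd l) ∨ E.IsExit (G.phiEnd l) := by
  obtain ⟨v, rfl⟩ := h
  rcases E.exit_line v with ⟨h1, -⟩ | ⟨h1, -⟩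
  · exact Or.inl (h1 ▸ E.isExit_mk v)
  · exact Or.inr (h1 ▸ E.isExit_mk v)

/-- The scale of the decay of the factor of a field: at a loop line, one end decays at the long
scale and the other one, relative to it, at the short scale; the end of a tree line
that is not eliminated decays at the short scale relative to the other end. -/
noncomputable def scale (s : L → ℝ) : G.Field → ℝ :=
  G.fieldCases (fun _ => 1) (fun l => if E.IsExit (G.phiEnd l) then s l else (s l)⁻¹) s

/-- The field relative to which the factor of a field decays, if any. -/
noncomputable def partner : G.Field → Option G.Field :=
  G.fieldCases (fun _ => none)
    (fun l => if E.IsExit (G.phiEnd l) then some (G.phiEnd l) else none)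
    (fun l => some (G.barEnd l))

/-- An order of integration: first over the fields on tree lines, from the root to the leaves, as
they are measured from exit fields of higher vertices, then over the `φ` ends of the loop
lines, then over the fields that have no partner. -/
noncomputable def order [Fintype V] : G.Field → ℕ :=
  G.fieldCases (fun _ => Finset.univ.sup T.rank + 1)
    (fun l => if E.IsExit (G.phiEnd l) then T.rank (G.barEnd l).1 else
      Finset.univ.sup T.rank + 1)
    (fun l => if E.IsExit (G.barEnd l) then T.rank (G.phiEnd l).1 else Finset.univ.sup T.rank)

theorem rank_le_order [Fintype V] (f : G.Field) : T.rank f.1 ≤ E.order f := by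
  have h : ∀ v, T.rank v ≤ Finset.univ.sup T.rank := fun v => Finset.le_sup (Finset.mem_univ v)
  refine G.field_induction (P := fun f => T.rank f.1 ≤ E.order f) (fun e => ?_) (fun l => ?_)
    (fun l => ?_) f
  · simpa [order] using (h _).trans (Nat.le_succ _)
  · simp only [order, fieldCases_barEnd]
    split_ifs
    exacts [le_rfl, (h _).trans (Nat.le_succ _)]
  · simp only [order, fieldCases_phiEnd]
    split_ifs
    exacts [le_rfl, h _]

/-- The product of the decaying factors of all fields whose positions are not eliminated. -/
noncomputable def planeFactor (s : L → ℝ) (x : G.Field → Plane) (f : G.Field) : ℝ :=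
  if E.IsExit f then 1 else
    decay (E.scale s f • (x f - (E.partner f).elim 0 x))

theorem planeFactor_nonneg (s : L → ℝ) (x : G.Field → Plane) (f : G.Field) :
    0 ≤ E.planeFactor s x f := by
  unfold planeFactor
  split_ifs
  exacts [zero_le_one, (decay_pos _).le]

theorem lintegral_prod_planeFactor_eq [Fintype V] (s : L → ℝ) (hs : ∀ l, 0 < s l) :
    ∫⁻ y : (v : V) → Fin (G.kind v).lastIndex → Plane, ENNReal.ofReal
      (∏ f : G.Field, E.planeFactor s (fun f' => vertexPositions (y f'.1) f'.2) f) =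
    ENNReal.ofReal (∏ f : G.Field, if E.IsExit f then 1 else
      (E.scale s f ^ 2)⁻¹ * ∫ x : Plane, decay x) := by
  refine G.lintegral_prod_decay_eq E.exit (E.scale s) (fun f => ?_) E.partner E.order
    (fun f f' => ?_) (fun f f' => ?_)
  · refine G.field_induction (P := fun f => 0 < E.scale s f) (fun e => ?_) (fun l => ?_)
      (fun l => ?_) f
    · simp [scale]
    · simp only [scale, fieldCases_barEnd]
      have := hs l
      split_ifs <;> positivity
    · simpa [scale] using hs l
  · refine G.field_induction (P := fun f => ¬E.IsExit f → E.partner f = some f' →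
      ¬E.IsExit f' → E.order f < E.order f') (fun e => ?_) (fun l => ?_) (fun l => ?_) f
    · simp [partner]
    · intro _ hp hf'
      simp only [partner, fieldCases_barEnd] at hp
      split_ifs at hp with h
      cases hp
      exact (hf' h).elim
    · intro hf hp hf'
      simp only [partner, fieldCases_phiEnd, Option.some.injEq] at hp
      subst hp
      simp only [order, fieldCases_phiEnd, fieldCases_barEnd]
      rw [if_neg hf', if_neg hf]
      exact Nat.lt_succ_self _
  · refine G.field_induction (P := fun f => ¬E.IsExit f → E.partner f = some f' →
      E.IsExit f' → ∀ g : G.Field, g.1 = f'.1 → ¬E.IsExit g →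
      E.order f < E.order g) (fun e => ?_) (fun l => ?_) (fun l => ?_) f
    · simp [partner]
    · intro _ hp hf' g hg _
      simp only [partner, fieldCases_barEnd] at hp
      split_ifs at hp with h
      cases hp
      refine lt_of_lt_of_le ?_ (E.rank_le_order g)
      simp only [order, fieldCases_barEnd, if_pos h]
      rw [hg]
      exact (E.isExit_phiEnd h).2
    · intro _ hp hf' g hg _
      simp only [partner, fieldCases_phiEnd, Option.some.injEq] at hp
      subst hp
      refine lt_of_lt_of_le ?_ (E.rank_le_order g)
      simp only [order, fieldCases_phiEnd]
      rw [if_pos hf', hg]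
      exact (E.isExit_barEnd hf').2

/-- The decay of a propagator in the plane pays for the factors of its two ends. -/
theorem decay_le_planeFactor_mul {s : L → ℝ} {l : L} (hs : 1 ≤ s l) (x : G.Field → Plane) :
    decay (s l • (x (G.barEnd l) - x (G.phiEnd l))) ^ 2 *
        decay ((s l)⁻¹ • (x (G.barEnd l) + x (G.phiEnd l))) ≤
      E.planeFactor s x (G.barEnd l) * E.planeFactor s x (G.phiEnd l) := by
  set u := x (G.barEnd l) - x (G.phiEnd l) with hu
  set v := x (G.barEnd l) + x (G.phiEnd l) with hv
  have hu0 := decay_pos (s l • u)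
  have hu1 := decay_le_one (s l • u)
  have hv0 := decay_pos ((s l)⁻¹ • v)
  have hv1 := decay_le_one ((s l)⁻¹ • v)
  have huneg : decay (s l • (x (G.phiEnd l) - x (G.barEnd l))) = decay (s l • u) := by
    rw [hu, ← decay_neg, ← smul_neg, neg_sub]
  have hsimple : decay (s l • u) ^ 2 * decay ((s l)⁻¹ • v) ≤ decay (s l • u) := by
    calc _ ≤ decay (s l • u) ^ 2 * 1 := by gcongr
      _ ≤ decay (s l • u) := by nlinarith
  by_cases hb : E.IsExit (G.barEnd l)
  · have hp : ¬ E.IsExit (G.phiEnd l) := fun hp =>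
      absurd (E.isExit_barEnd hb).2 (E.isExit_phiEnd hp).2.not_gt
    rw [planeFactor, planeFactor, if_pos hb, if_neg hp, one_mul]
    simpa [scale, partner, huneg] using hsimple
  · by_cases hp : E.IsExit (G.phiEnd l)
    · rw [planeFactor, planeFactor, if_pos hp, if_neg hb, mul_one]
      simpa [scale, partner, hp] using hsimple
    · rw [planeFactor, planeFactor, if_neg hp, if_neg hb]
      simp only [scale, partner, fieldCases_barEnd, fieldCases_phiEnd, if_neg hp,
        Option.elim_none, Option.elim_some, sub_zero, huneg]
      have := decay_mul_decay_le hs (u := u) (v := v) (x := x (G.barEnd l))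
        (by rw [hu, hv, two_smul]; abel)
      calc _ = decay (s l • u) * decay ((s l)⁻¹ • v) * decay (s l • u) := by ring
        _ ≤ _ := by gcongr

/-- The weights of the fields multiply up to `s ^ (-2)` for a line of the tree, and to a constant
for a loop line, as the long scale of its one end compensates the short scale of the other. -/
theorem prod_weight_le [Fintype V] [DecidableEq V] [Fintype L] [Fintype G.ExternalField]
    {s : L → ℝ} (hs : ∀ l, 0 < s l) {I C : ℝ} (hI : 0 ≤ I) (hIC : I ≤ C) (hC : 1 ≤ C) :
    (∏ f : G.Field, if E.IsExit f then 1 else (E.scale s f ^ 2)⁻¹ * I) ≤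
      C ^ Fintype.card G.ExternalField * (C ^ 2) ^ Fintype.card L *
        ∏ v, (s (T.line v) ^ 2)⁻¹ := by
  classical
  have hC0 : 0 < C := by linarith
  have htree : ∏ v, (s (T.line v) ^ 2)⁻¹ =
      ∏ l, if l ∈ Set.range T.line then (s l ^ 2)⁻¹ else 1 := by
    rw [← Finset.prod_filter, ← Finset.prod_image (s := Finset.univ) (g := T.line)
      (f := fun l => (s l ^ 2)⁻¹) T.line_injective.injOn]
    congr 1
    ext l
    simp
  rw [G.prod_field, htree, mul_assoc, Fintype.card, Fintype.card, ← Finset.prod_const,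
    ← Finset.prod_const (s := (Finset.univ : Finset L)), ← Finset.prod_mul_distrib]
  have hnn : ∀ f : G.Field, 0 ≤ if E.IsExit f then 1 else (E.scale s f ^ 2)⁻¹ * I := by
    intro f
    split_ifs <;> positivity
  refine mul_le_mul ?_ ?_ (Finset.prod_nonneg fun l _ => mul_nonneg (hnn _) (hnn _))
    (by positivity)
  · refine Finset.prod_le_prod (fun e _ => hnn _) fun e _ => ?_
    split_ifs
    · exact hC
    · simpa [scale] using hIC
  · refine Finset.prod_le_prod (fun l _ => mul_nonneg (hnn _) (hnn _)) fun l _ => ?_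
    have hsl := hs l
    have hCC : C ≤ C ^ 2 := le_self_pow₀ hC two_ne_zero
    by_cases hb : E.IsExit (G.barEnd l)
    · have hp : ¬ E.IsExit (G.phiEnd l) := fun hp =>
        absurd (E.isExit_barEnd hb).2 (E.isExit_phiEnd hp).2.not_gt
      rw [if_pos hb, if_neg hp, if_pos (E.isExit_barEnd hb).1, one_mul, mul_comm]
      simp only [scale, fieldCases_phiEnd]
      gcongr
      exact hIC.trans hCC
    · by_cases hp : E.IsExit (G.phiEnd l)
      · rw [if_neg hb, if_pos hp, if_pos (E.isExit_phiEnd hp).1, mul_one, mul_comm]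
        simp only [scale, fieldCases_barEnd, if_pos hp]
        gcongr
        exact hIC.trans hCC
      · have hl : l ∉ Set.range T.line := fun h => (E.isExit_or_of_mem_range h).elim hb hp
        rw [if_neg hb, if_neg hp, if_neg hl]
        simp only [scale, fieldCases_barEnd, fieldCases_phiEnd, if_neg hp]
        calc _ = I ^ 2 := by field_simp
          _ ≤ C ^ 2 * 1 := by rw [mul_one]; gcongr

end ExitFields

/-! ### The bound on amplitudes -/

theorem continuous_pos (f : G.Field) : Continuous fun p : G.Config => G.pos p f := by
  unfold pos
  exact (continuous_apply f.2).comp (continuous_vertexPositions.comp (by fun_prop))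

theorem continuous_pos₀ (f : G.Field) : Continuous fun p : G.Config => G.pos₀ p f := by
  unfold pos₀
  fun_prop

theorem norm_vertexPhase (θ : ℝ) {k : ℕ} (x : Fin k → Plane) : ‖vertexPhase θ x‖ = 1 := by
  unfold vertexPhase
  rw [mul_comm, Complex.norm_exp_ofReal_mul_I]

theorem continuous_vertexPhase (θ : ℝ) {k : ℕ} :
    Continuous (vertexPhase θ : (Fin k → Plane) → ℂ) := by
  unfold vertexPhase thetaForm
  fun_prop

theorem measurable_slicedIntegrand [Fintype V] [Fintype L] [Fintype G.ExternalField]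
    (θ Ω m M : ℝ) (F : G.ExternalField → 𝓢(Plane × ℝ, ℂ)) (μ : L → ℕ) :
    Measurable (G.slicedIntegrand θ Ω m M F μ) := by
  have hpos := fun f => (G.continuous_pos f).measurable
  have hpos₀ := fun f => (G.continuous_pos₀ f).measurable
  unfold slicedIntegrand
  refine ((Finset.measurable_fun_prod _ fun v _ => ?_).mul
    (Finset.measurable_fun_prod _ fun l _ => ?_)).mul
    (Finset.measurable_fun_prod _ fun e _ => ?_)
  · have h : Measurable fun (p : G.Config) (j : Fin (G.kind v).valence) => G.pos p ⟨v, j⟩ :=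
      measurable_pi_lambda _ fun j => hpos ⟨v, j⟩
    exact (continuous_vertexPhase θ).measurable.comp h
  · have h : Measurable fun p : G.Config => (G.pos p (G.barEnd l) - G.pos p (G.phiEnd l),
        G.pos₀ p (G.barEnd l) - G.pos₀ p (G.phiEnd l),
        G.pos p (G.barEnd l) + G.pos p (G.phiEnd l)) :=
      ((hpos (G.barEnd l)).sub (hpos (G.phiEnd l))).prodMk
        (((hpos₀ (G.barEnd l)).sub (hpos₀ (G.phiEnd l))).prodMk
          ((hpos (G.barEnd l)).add (hpos (G.phiEnd l))))
    have h' := (measurable_propagatorSlice Ω m M (μ l)).comp h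
    exact Complex.measurable_ofReal.comp h'
  · exact (F e).continuous.measurable.comp ((hpos e.1).prodMk (hpos₀ e.1))

/-- The integrand is bounded by a product of a function of the positions in the plane and a
function of the commuting coordinates. Of the decay in the commuting coordinates only that of the
tree lines and of one external field is kept. -/
theorem norm_slicedIntegrand_le [Fintype V] [DecidableEq V] [Fintype L]
    [Fintype G.ExternalField] {θ Ω m M : ℝ} (hM : 1 < M)
    {K₁ : ℝ} (hK₁ : 1 ≤ K₁) (hprop : ∀ (i : ℕ) (u : Plane) (u₀ : ℝ) (v : Plane),
      |propagatorSlice Ω m M i u u₀ v| ≤ K₁ * M ^ i *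
        (decay (M ^ i • u) ^ 2 * decay ((M ^ i)⁻¹ • v) * decay (M ^ i • u₀)))
    {F : G.ExternalField → 𝓢(Plane × ℝ, ℂ)} {K₂ : ℝ} (hK₂ : 1 ≤ K₂)
    (hF : ∀ (e : G.ExternalField) (x : Plane) (t : ℝ), ‖F e (x, t)‖ ≤ K₂ * (decay x * decay t))
    {μ : L → ℕ} {e₀ : G.ExternalField} {T : G.ScaleTree μ e₀.1.1} (E : ExitFields e₀ T)
    (p : G.Config) :
    ‖G.slicedIntegrand θ Ω m M F μ p‖ ≤
      (K₁ ^ Fintype.card L * (∏ l, M ^ μ l) * K₂ ^ Fintype.card G.ExternalField) *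
      ((∏ f : G.Field, E.planeFactor (fun l => M ^ μ l) (G.pos p) f) *
      (decay (p.2 e₀.1.1) * ∏ v, decay (M ^ μ (T.line v) •
        (p.2 (G.barEnd (T.line v)).1 - p.2 (G.phiEnd (T.line v)).1)))) := by
  classical
  have hM0 : 0 < M := by linarith
  set n : G.Field → ℝ := E.planeFactor (fun l => M ^ μ l) (G.pos p) with hn
  have hn0 : ∀ f, 0 ≤ n f := E.planeFactor_nonneg _ _
  set κ : L → ℝ := fun l => decay (M ^ μ l • (p.2 (G.barEnd l).1 - p.2 (G.phiEnd l).1)) with hκ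
  have hκ0 : ∀ l, 0 < κ l := fun l => decay_pos _
  have hlines : ∏ l : L, |propagatorSlice Ω m M (μ l)
      (G.pos p (G.barEnd l) - G.pos p (G.phiEnd l))
      (G.pos₀ p (G.barEnd l) - G.pos₀ p (G.phiEnd l))
      (G.pos p (G.barEnd l) + G.pos p (G.phiEnd l))| ≤
      K₁ ^ Fintype.card L * (∏ l, M ^ μ l) * (∏ l, n (G.barEnd l) * n (G.phiEnd l)) *
        ∏ v, κ (T.line v) := by
    have hκtree : ∏ l, κ l ≤ ∏ v, κ (T.line v) := by
      rw [← Finset.prod_image (s := Finset.univ) (g := T.line) (f := κ) T.line_injective.injOn]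
      exact Finset.prod_le_prod_of_subset_of_le_one (Finset.subset_univ _)
        (fun l _ => (hκ0 l).le) fun l _ _ => decay_le_one _
    calc _ ≤ ∏ l, K₁ * M ^ μ l * (n (G.barEnd l) * n (G.phiEnd l)) * κ l := by
          refine Finset.prod_le_prod (fun l _ => abs_nonneg _) fun l _ => ?_
          refine (hprop (μ l) _ _ _).trans ?_
          rw [mul_assoc (K₁ * M ^ μ l)]
          refine mul_le_mul_of_nonneg_left ?_ (by positivity)
          exact mul_le_mul_of_nonneg_right
            (E.decay_le_planeFactor_mul (s := fun l => M ^ μ l) (one_le_pow₀ hM.le) (G.pos p))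
            (hκ0 l).le
      _ = K₁ ^ Fintype.card L * (∏ l, M ^ μ l) * (∏ l, n (G.barEnd l) * n (G.phiEnd l)) *
          ∏ l, κ l := by
          simp only [Finset.prod_mul_distrib, Finset.prod_const, Finset.card_univ]
      _ ≤ _ := by
          refine mul_le_mul_of_nonneg_left hκtree ?_
          have : 0 ≤ ∏ l, n (G.barEnd l) * n (G.phiEnd l) :=
            Finset.prod_nonneg fun l _ => mul_nonneg (hn0 _) (hn0 _)
          positivity
  have hext : ∏ e : G.ExternalField, ‖F e (G.pos p e.1, G.pos₀ p e.1)‖ ≤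
      K₂ ^ Fintype.card G.ExternalField * (∏ e : G.ExternalField, n e.1) *
        decay (p.2 e₀.1.1) := by
    calc _ ≤ ∏ e : G.ExternalField, K₂ * n e.1 * if e = e₀ then decay (p.2 e₀.1.1) else 1 := by
          refine Finset.prod_le_prod (fun e _ => norm_nonneg _) fun e _ => ?_
          refine (hF e _ _).trans ?_
          rw [mul_assoc]
          refine mul_le_mul_of_nonneg_left ?_ (by positivity)
          have h1 := decay_le_one (G.pos p e.1)
          have h2 := decay_le_one (G.pos₀ p e.1)
          have h3 := decay_pos (G.pos p e.1)
          have h4 := decay_pos (G.pos₀ p e.1)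
          by_cases he : e = e₀
          · have hne : n e.1 = 1 := by
              rw [hn, ExitFields.planeFactor, if_pos ((E.isExit_external_iff e).2 he)]
            rw [hne, if_pos he, one_mul, he]
            rw [he] at h1 h4
            exact mul_le_of_le_one_left h4.le h1
          · have hne : n e.1 = decay (G.pos p e.1) := by
              rw [hn, ExitFields.planeFactor, if_neg fun h => he ((E.isExit_external_iff e).1 h)]
              simp [ExitFields.scale, ExitFields.partner]
            rw [hne, if_neg he]
            gcongr
      _ = _ := by
          simp only [Finset.prod_mul_distrib, Finset.prod_const, Finset.card_univ,
            Finset.prod_ite_eq', Finset.mem_univ, if_true]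
  unfold slicedIntegrand
  rw [norm_mul, norm_mul, norm_prod, norm_prod, norm_prod,
    Finset.prod_eq_one fun v _ => norm_vertexPhase θ _, one_mul]
  simp only [Complex.norm_real, Real.norm_eq_abs]
  refine (mul_le_mul hlines hext (Finset.prod_nonneg fun e _ => norm_nonneg _) ?_).trans_eq ?_
  · have h1 : 0 ≤ ∏ l, n (G.barEnd l) * n (G.phiEnd l) :=
      Finset.prod_nonneg fun l _ => mul_nonneg (hn0 _) (hn0 _)
    have h2 : 0 ≤ ∏ v, κ (T.line v) := Finset.prod_nonneg fun v _ => (hκ0 _).le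
    positivity
  · rw [G.prod_field]
    ring

theorem powerCounting_nonneg [Fintype L] {M : ℝ} (hM : 0 ≤ M) (μ : L → ℕ) :
    0 ≤ G.powerCounting M μ :=
  Finset.prod_nonneg fun _ _ => finprod_nonneg fun _ => Real.rpow_nonneg hM _

/-- The bound on the integral of the absolute value, from the bounds on the propagator and on the
test functions. -/
theorem lintegral_enorm_slicedIntegrand_le [Fintype V] [Fintype L]
    [Fintype G.ExternalField] {θ Ω m M : ℝ} (hM : 1 < M) (hG : G.Connected)
    {K₁ : ℝ} (hK₁ : 1 ≤ K₁) (hprop : ∀ (i : ℕ) (u : Plane) (u₀ : ℝ) (v : Plane),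
      |propagatorSlice Ω m M i u u₀ v| ≤ K₁ * M ^ i *
        (decay (M ^ i • u) ^ 2 * decay ((M ^ i)⁻¹ • v) * decay (M ^ i • u₀)))
    {F : G.ExternalField → 𝓢(Plane × ℝ, ℂ)} {K₂ : ℝ} (hK₂ : 1 ≤ K₂)
    (hF : ∀ (e : G.ExternalField) (x : Plane) (t : ℝ), ‖F e (x, t)‖ ≤ K₂ * (decay x * decay t))
    (μ : L → ℕ) (e₀ : G.ExternalField) {C₁ C₂ : ℝ} (hC₁1 : 1 ≤ C₁) (hC₂1 : 1 ≤ C₂)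
    (hIC₁ : ∫ x : ℝ, decay x ≤ C₁) (hIC₂ : ∫ x : Plane, decay x ≤ C₂) :
    ∫⁻ p, ‖G.slicedIntegrand θ Ω m M F μ p‖ₑ ≤ ENNReal.ofReal
      (((K₁ * C₂ ^ 2) ^ 6 * (K₂ * C₂) ^ 6 * C₁) ^ Fintype.card V * G.powerCounting M μ) := by
  classical
  have hM0 : 0 < M := by linarith
  set I₂ : ℝ := ∫ x : Plane, decay x with hI₂
  set I₁ : ℝ := ∫ x : ℝ, decay x with hI₁
  have hI₂0 : 0 ≤ I₂ := integral_nonneg fun x => (decay_pos x).le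
  have hI₁0 : 0 ≤ I₁ := integral_nonneg fun x => (decay_pos x).le
  obtain ⟨T⟩ := G.nonempty_scaleTree hG μ e₀.1.1
  obtain ⟨E⟩ := nonempty_exitFields e₀ T
  have hs : ∀ l, 0 < (fun l => M ^ μ l) l := fun l => pow_pos hM0 _
  have hbound := G.norm_slicedIntegrand_le (θ := θ) hM hK₁ hprop hK₂
    hF E
  set A : ℝ := K₁ ^ Fintype.card L * (∏ l, M ^ μ l) * K₂ ^ Fintype.card G.ExternalField with hA
  have hA0 : 0 ≤ A := by positivity
  set B : ℝ := ∏ f : G.Field,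
    if E.IsExit f then 1 else (E.scale (fun l => M ^ μ l) f ^ 2)⁻¹ * I₂ with hB
  set D : ℝ := I₁ * ∏ v, (M ^ μ (T.line v))⁻¹ * I₁ with hD
  have hB0 : 0 ≤ B := Finset.prod_nonneg fun f _ => by split_ifs <;> positivity
  have hD0 : 0 ≤ D := by positivity
  have hfinal : A * (B * D) ≤ ((K₁ * C₂ ^ 2) ^ 6 * (K₂ * C₂) ^ 6 * C₁) ^ Fintype.card V *
      G.powerCounting M μ := by
    have hBle : B ≤ _ := E.prod_weight_le hs hI₂0 hIC₂ hC₂1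
    have hDle : D ≤ C₁ ^ Fintype.card V * ∏ v, (M ^ μ (T.line v))⁻¹ := by
      have hcard : Fintype.card V = Fintype.card {v // v ≠ e₀.1.1} + 1 := by
        have : 0 < Fintype.card V := Fintype.card_pos_iff.2 ⟨e₀.1.1⟩
        rw [Fintype.card_subtype_compl, Fintype.card_subtype_eq]
        omega
      rw [hD, Finset.prod_mul_distrib, Finset.prod_const, Finset.card_univ, hcard, pow_succ]
      calc _ = I₁ ^ Fintype.card {v // v ≠ e₀.1.1} * I₁ * ∏ v, (M ^ μ (T.line v))⁻¹ := by ring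
        _ ≤ _ := by gcongr
    have hext : Fintype.card G.ExternalField ≤ 6 * Fintype.card V :=
      (Fintype.card_le_of_injective _ Subtype.val_injective).trans G.card_field_le
    have hline : Fintype.card L ≤ 6 * Fintype.card V :=
      (Fintype.card_le_of_injective _ G.barEnd_injective).trans G.card_field_le
    have hK₁C : 1 ≤ K₁ * C₂ ^ 2 := one_le_mul_of_one_le_of_one_le hK₁ (one_le_pow₀ hC₂1)
    have hK₂C : 1 ≤ K₂ * C₂ := one_le_mul_of_one_le_of_one_le hK₂ hC₂1
    have hpc := T.prod_le_powerCounting hM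
    have htree : (∏ v, (M ^ (3 * μ (T.line v)))⁻¹) =
        (∏ v, ((M ^ μ (T.line v)) ^ 2)⁻¹) * ∏ v, (M ^ μ (T.line v))⁻¹ := by
      rw [← Finset.prod_mul_distrib]
      refine Finset.prod_congr rfl fun v _ => ?_
      rw [← mul_inv, ← pow_succ, ← pow_mul, mul_comm]
    calc A * (B * D) ≤ A * ((C₂ ^ Fintype.card G.ExternalField * (C₂ ^ 2) ^ Fintype.card L *
          ∏ v, ((M ^ μ (T.line v)) ^ 2)⁻¹) * (C₁ ^ Fintype.card V *
          ∏ v, (M ^ μ (T.line v))⁻¹)) := by gcongr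
      _ = (K₁ * C₂ ^ 2) ^ Fintype.card L * (K₂ * C₂) ^ Fintype.card G.ExternalField *
          C₁ ^ Fintype.card V * ((∏ l, M ^ μ l) * ∏ v, (M ^ (3 * μ (T.line v)))⁻¹) := by
          rw [htree, hA, mul_pow, mul_pow]
          ring
      _ ≤ (K₁ * C₂ ^ 2) ^ (6 * Fintype.card V) * (K₂ * C₂) ^ (6 * Fintype.card V) *
          C₁ ^ Fintype.card V * G.powerCounting M μ := by gcongr
      _ = _ := by rw [pow_mul, pow_mul, mul_pow _ C₁, mul_pow ((K₁ * C₂ ^ 2) ^ 6)]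
  refine le_trans ?_ (ENNReal.ofReal_le_ofReal hfinal)
  have hplane := E.lintegral_prod_planeFactor_eq (fun l => M ^ μ l) hs
  have hcomm := T.lintegral_prod_decay_eq (fun l => M ^ μ l) hs
  have hmeas : ∀ f : G.Field, Measurable fun y : (v : V) → Fin (G.kind v).lastIndex → Plane =>
      E.planeFactor (fun l => M ^ μ l) (fun f' => vertexPositions (y f'.1) f'.2) f := by
    intro f
    have hpos : ∀ f' : G.Field, Measurable fun y : (v : V) → Fin (G.kind v).lastIndex → Plane =>
        vertexPositions (y f'.1) f'.2 := fun f' =>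
      ((continuous_apply f'.2).comp (continuous_vertexPositions.comp (by fun_prop))).measurable
    unfold ExitFields.planeFactor
    split_ifs
    · exact measurable_const
    · have hpart : Measurable fun y : (v : V) → Fin (G.kind v).lastIndex → Plane =>
          (E.partner f).elim 0 fun f' : G.Field => vertexPositions (y f'.1) f'.2 := by
        cases E.partner f with
        | none => exact measurable_const
        | some f' => exact hpos f'
      have hsub := ((hpos f).sub hpart).const_smul (E.scale (fun l => M ^ μ l) f)
      exact continuous_decay.measurable.comp hsub
  have hmeas₂ : Measurable fun y : (v : V) → Fin (G.kind v).lastIndex → Plane =>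
      ENNReal.ofReal (∏ f : G.Field, E.planeFactor (fun l => M ^ μ l)
        (fun f' => vertexPositions (y f'.1) f'.2) f) :=
    ENNReal.measurable_ofReal.comp (Finset.measurable_fun_prod _ fun f _ => hmeas f)
  have hmeas₁ : Measurable fun t : V → ℝ => ENNReal.ofReal (decay (t e₀.1.1) * ∏ v,
      decay (M ^ μ (T.line v) • (t (G.barEnd (T.line v)).1 - t (G.phiEnd (T.line v)).1))) := by
    refine ENNReal.measurable_ofReal.comp (Measurable.mul ?_
      (Finset.measurable_fun_prod _ fun v _ => ?_))
    · exact continuous_decay.measurable.comp (measurable_pi_apply _)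
    · exact continuous_decay.measurable.comp (by fun_prop)
  calc _ ≤ ∫⁻ p : G.Config, ENNReal.ofReal A *
        (ENNReal.ofReal (∏ f : G.Field, E.planeFactor (fun l => M ^ μ l)
          (fun f' => vertexPositions (p.1 f'.1) f'.2) f) *
        ENNReal.ofReal (decay (p.2 e₀.1.1) * ∏ v, decay (M ^ μ (T.line v) •
          (p.2 (G.barEnd (T.line v)).1 - p.2 (G.phiEnd (T.line v)).1)))) := by
        refine lintegral_mono fun p => ?_
        rw [← ofReal_norm, ← ENNReal.ofReal_mul, ← ENNReal.ofReal_mul hA0]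
        · exact ENNReal.ofReal_le_ofReal (hbound p)
        · exact Finset.prod_nonneg fun f _ => E.planeFactor_nonneg _ _ _
    _ = ENNReal.ofReal A * (ENNReal.ofReal B * ENNReal.ofReal D) := by
        rw [lintegral_const_mul' _ _ ENNReal.ofReal_ne_top, hB, hD, hI₂, hI₁, ← hplane, ← hcomm]
        exact congrArg _ (lintegral_prod_mul hmeas₂.aemeasurable hmeas₁.aemeasurable)
    _ = _ := by rw [← ENNReal.ofReal_mul hB0, ← ENNReal.ofReal_mul hA0]

end FeynmanGraph

end NCPhi6

theorem mainTheorem3 (θ Ω m M : ℝ) (hθ : θ ≠ 0) (hΩ : 0 < Ω) (hM : 1 < M)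
    (𝓕 : Set 𝓢(NCPhi6.Plane × ℝ, ℂ))
    (h𝓕 : ∀ a b : ℕ, ∃ C : ℝ, ∀ f ∈ 𝓕, SchwartzMap.seminorm ℝ a b f ≤ C) :
    ∃ K : ℝ, 0 < K ∧
      ∀ (V L : Type) [Fintype V] [Fintype L] (G : NCPhi6.FeynmanGraph V L)
        [Fintype G.ExternalField],
        G.Connected → Nonempty G.ExternalField →
        ∀ F : G.ExternalField → 𝓢(NCPhi6.Plane × ℝ, ℂ), (∀ e, F e ∈ 𝓕) →
        ∀ μ : L → ℕ,
          Integrable (G.slicedIntegrand θ Ω m M F μ) ∧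
          ‖G.slicedAmplitude θ Ω m M F μ‖ ≤ K ^ Fintype.card V * G.powerCounting M μ := by
  obtain ⟨K₁, hK₁, hprop⟩ := NCPhi6.exists_abs_propagatorSlice_le m hΩ hM
  obtain ⟨K₂, hK₂, hF𝓕⟩ := NCPhi6.exists_norm_le_decay_mul_decay 𝓕 h𝓕
  set C₁ : ℝ := max 1 (∫ x : ℝ, NCPhi6.decay x)
  set C₂ : ℝ := max 1 (∫ x : NCPhi6.Plane, NCPhi6.decay x)
  have hC₁ : 1 ≤ C₁ := le_max_left _ _
  have hC₂ : 1 ≤ C₂ := le_max_left _ _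
  -- a graph with `n` vertices has at most `6 * n` lines and `6 * n` external fields
  refine ⟨(K₁ * C₂ ^ 2) ^ 6 * (K₂ * C₂) ^ 6 * C₁, by positivity,
    fun V L _ _ G _ hG ⟨e₀⟩ F hF μ => ?_⟩
  have hlint := G.lintegral_enorm_slicedIntegrand_le (θ := θ) hM hG hK₁ hprop hK₂
    (fun e => hF𝓕 (F e) (hF e)) μ e₀ hC₁ hC₂ (le_max_right _ _) (le_max_right _ _)
  refine ⟨⟨(G.measurable_slicedIntegrand θ Ω m M F μ).aestronglyMeasurable,
    hlint.trans_lt ENNReal.ofReal_lt_top⟩, ?_⟩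
  have h := (enorm_integral_le_lintegral_enorm (G.slicedIntegrand θ Ω m M F μ)).trans hlint
  rw [← ofReal_norm] at h
  refine (ENNReal.ofReal_le_ofReal_iff ?_).1 h
  exact mul_nonneg (by positivity) (G.powerCounting_nonneg (by linarith) μ)
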